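/- Let $\mathcal X,\mathcal Y_1,\mathcal Y_2$ be finite sets and let $P(y_1,y_2|x)$ be the transition probabilities of a discrete memoryless broadcast channel, so that $P(\mathbf y_1,\mathbf y_2|\mathbf x)=\prod_{i=1}^n P(y_{1,i},y_{2,i}|x_i)$. Logarithms and information quantities are to base $2$. A code of block length $n\ge 1$ with message sets $\mathcal W_t=\{1,\dots,M_t\}$, $t=1,2$, consists of a stochastic encoder, i.e. conditional probabilities $f(\mathbf x|w_1,w_2)$ with $\mathbf x\in\mathcal X^n$ and $\sum_{\mathbf x}f(\mathbf x|w_1,w_2)=1$, and of decoders $\phi_t:\mathcal Y_t^n\to\mathcal W_t$. The messages $W_1,W_2$ are independent and uniformly distributed, and $P_{e,t}=\frac1{M_1M_2}\sum_{w_1,w_2}\Pr[\phi_t(\mathbf Y_t)\ne w_t\mid (w_1,w_2)\text{ sent}]$. A pair $(R_1,R_2)$ of non-negative reals is *achievable* for the broadcast channel with confidential messages if for every $\epsilon_0>0$ there is such a code with $$M_t\ge 2^{nR_t}\ (t=1,2),\qquad \max\{P_{e,1},P_{e,2}\}\le\epsilon_0,$$ $$nR_1-H(W_1|\mathbf Y_2)\le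 n\epsilon_0,\qquad nR_2-H(W_2|\mathbf Y_1)\le n\epsilon_0 .$$ The *capacity region* is the closure in $\mathbb R^2$ of the set of achievable pairs. Let $U,V_1,V_2$ be auxiliary random variables with finite alphabets, and let $P(u,v_1,v_2,x,y_1,y_2)$ be any joint distribution that factors as $P(u)\,P(v_1,v_2|u)\,P(x|v_1,v_2)\,P(y_1,y_2|x)$, where the last factor is the given channel. Put $$I_1=I(V_1;Y_1|U)-I(V_1;V_2|U)-I(V_1;Y_2|V_2,U),$$ $$I_2=I(V_2;Y_2|U)-I(V_1;V_2|U)-I(V_2;Y_1|V_1,U).$$ Then every pair $(R_1,R_2)$ with $0\le R_1\le I_1$ and $0\le R_2\le I_2$ belongs to the capacity region. Moreover, if in addition, for each $t\in\{1,2\}$, $R_t=0$ or $R_t<I_t$, then $(R_1,R_2)$ is itself achievable. -/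

import Mathlib

namespace BCCM

/-! Finite probability: a probability distribution on a finite type `Ω` is an element of
`stdSimplex ℝ Ω`, and a random variable is a function on `Ω`. All logarithms are to base 2. -/

open Classical in
/-- The law of the random variable `f` when the sample point is drawn from `p`:
`law p f a = P[f = a]`. -/
noncomputable def law {Ω α : Type*} [Fintype Ω] (p : Ω → ℝ) (f : Ω → α) (a : α) : ℝ :=
  ∑ ω with f ω = a, p ω

/-- Conditional entropy in bits,
`H(f | g) = - ∑ P[f = a, g = b] log₂ (P[f = a, g = b] / P[g = b])`. -/
noncomputable def condEntropy {Ω α β : Type*} [Fintype Ω] [Fintype α] [Fintype β]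
    (p : Ω → ℝ) (f : Ω → α) (g : Ω → β) : ℝ :=
  -∑ a, ∑ b, law p (fun ω => (f ω, g ω)) (a, b) *
    Real.logb 2 (law p (fun ω => (f ω, g ω)) (a, b) / law p g b)

/-- Conditional mutual information in bits, `I(f ; g | h) = H(f | h) - H(f | g, h)`. -/
noncomputable def condMutualInfo {Ω α β γ : Type*} [Fintype Ω] [Fintype α] [Fintype β]
    [Fintype γ] (p : Ω → ℝ) (f : Ω → α) (g : Ω → β) (h : Ω → γ) : ℝ :=
  condEntropy p f h - condEntropy p f (fun ω => (g ω, h ω))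

/-- The transition probabilities `P(y₁, y₂ | x)` of a broadcast channel with finite alphabets. -/
structure BroadcastChannel (X Y₁ Y₂ : Type*) [Fintype Y₁] [Fintype Y₂] where
  prob : X → Y₁ × Y₂ → ℝ
  prob_mem : ∀ x, prob x ∈ stdSimplex ℝ (Y₁ × Y₂)

section Model

variable {X Y₁ Y₂ : Type*} [Fintype X] [Fintype Y₁] [Fintype Y₂]

/-- Memoryless use of the channel `n` times; `y i` is the pair of outputs at time `i`. -/
noncomputable def BroadcastChannel.blockProb (W : BroadcastChannel X Y₁ Y₂) {n : ℕ}
    (x : Fin n → X) (y : Fin n → Y₁ × Y₂) : ℝ :=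
  ∏ i, W.prob (x i) (y i)

/-- A code with message sets `Fin M₁`, `Fin M₂` and block length `n`: a stochastic encoder
`f(x | w₁, w₂)` and a (deterministic) decoder for each receiver. -/
structure Code (X Y₁ Y₂ : Type*) [Fintype X] (n M₁ M₂ : ℕ) where
  enc : Fin M₁ × Fin M₂ → (Fin n → X) → ℝ
  enc_mem : ∀ w, enc w ∈ stdSimplex ℝ (Fin n → X)
  dec₁ : (Fin n → Y₁) → Fin M₁
  dec₂ : (Fin n → Y₂) → Fin M₂

namespace Code

variable {n M₁ M₂ : ℕ}

/-- Probability of error at receiver 1, averaged over the message pairs. -/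
noncomputable def error₁ (C : Code X Y₁ Y₂ n M₁ M₂) (W : BroadcastChannel X Y₁ Y₂) : ℝ :=
  ∑ w : Fin M₁ × Fin M₂, 1 / ((M₁ : ℝ) * M₂) *
    ∑ x, ∑ y with C.dec₁ (fun i => (y i).1) ≠ w.1, C.enc w x * W.blockProb x y

/-- Probability of error at receiver 2, averaged over the message pairs. -/
noncomputable def error₂ (C : Code X Y₁ Y₂ n M₁ M₂) (W : BroadcastChannel X Y₁ Y₂) : ℝ :=
  ∑ w : Fin M₁ × Fin M₂, 1 / ((M₁ : ℝ) * M₂) *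
    ∑ x, ∑ y with C.dec₂ (fun i => (y i).2) ≠ w.2, C.enc w x * W.blockProb x y

/-- The joint distribution of the (independent, uniform) messages, the channel input block and
the channel output blocks. -/
noncomputable def joint (C : Code X Y₁ Y₂ n M₁ M₂) (W : BroadcastChannel X Y₁ Y₂)
    (ω : (Fin M₁ × Fin M₂) × (Fin n → X) × (Fin n → Y₁ × Y₂)) : ℝ :=
  1 / ((M₁ : ℝ) * M₂) * C.enc ω.1 ω.2.1 * W.blockProb ω.2.1 ω.2.2

/-- `H(W₁ | 𝐘₂)`: equivocation of message 1 at receiver 2. -/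
noncomputable def equivocation₁ (C : Code X Y₁ Y₂ n M₁ M₂) (W : BroadcastChannel X Y₁ Y₂) : ℝ :=
  condEntropy (C.joint W) (fun ω => ω.1.1) (fun ω i => (ω.2.2 i).2)

/-- `H(W₂ | 𝐘₁)`: equivocation of message 2 at receiver 1. -/
noncomputable def equivocation₂ (C : Code X Y₁ Y₂ n M₁ M₂) (W : BroadcastChannel X Y₁ Y₂) : ℝ :=
  condEntropy (C.joint W) (fun ω => ω.1.2) (fun ω i => (ω.2.2 i).1)

end Code

/-- The rate pair `(R₁, R₂)` is achievable for the broadcast channel with confidential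
messages. -/
def Achievable (W : BroadcastChannel X Y₁ Y₂) (R₁ R₂ : ℝ) : Prop :=
  0 ≤ R₁ ∧ 0 ≤ R₂ ∧ ∀ ε : ℝ, 0 < ε →
    ∃ (n M₁ M₂ : ℕ) (C : Code X Y₁ Y₂ n M₁ M₂), 1 ≤ n ∧
      (2 : ℝ) ^ ((n : ℝ) * R₁) ≤ M₁ ∧ (2 : ℝ) ^ ((n : ℝ) * R₂) ≤ M₂ ∧
      max (C.error₁ W) (C.error₂ W) ≤ ε ∧
      n * R₁ - C.equivocation₁ W ≤ n * ε ∧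
      n * R₂ - C.equivocation₂ W ≤ n * ε

/-- The capacity region: the closure of the set of achievable rate pairs. -/
def capacityRegion (W : BroadcastChannel X Y₁ Y₂) : Set (ℝ × ℝ) :=
  closure {R | Achievable W R.1 R.2}

/-- The class of joint distributions of `(U, V₁, V₂, X, Y₁, Y₂)` that factor as
`P(u) P(v₁, v₂ | u) P(x | v₁, v₂) P(y₁, y₂ | x)`, the last factor being the channel `W`. -/
def piBC (W : BroadcastChannel X Y₁ Y₂) (U V₁ V₂ : Type*) [Fintype U] [Fintype V₁]
    [Fintype V₂] : Set (U × V₁ × V₂ × X × Y₁ × Y₂ → ℝ) :=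
  {P | ∃ (pU : U → ℝ) (pV : U → V₁ × V₂ → ℝ) (pX : V₁ × V₂ → X → ℝ),
    pU ∈ stdSimplex ℝ U ∧ (∀ u, pV u ∈ stdSimplex ℝ (V₁ × V₂)) ∧
    (∀ v, pX v ∈ stdSimplex ℝ X) ∧
    ∀ u v₁ v₂ x y₁ y₂, P (u, v₁, v₂, x, y₁, y₂) =
      pU u * pV u (v₁, v₂) * pX (v₁, v₂) x * W.prob x (y₁, y₂)}

end Model

section Bounds

variable {U V₁ V₂ X Y₁ Y₂ : Type*}

/-- The random variable `U`. -/
def rvU (ω : U × V₁ × V₂ × X × Y₁ × Y₂) : U := ω.1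
/-- The random variable `V₁`. -/
def rvV₁ (ω : U × V₁ × V₂ × X × Y₁ × Y₂) : V₁ := ω.2.1
/-- The random variable `V₂`. -/
def rvV₂ (ω : U × V₁ × V₂ × X × Y₁ × Y₂) : V₂ := ω.2.2.1
/-- The random variable `Y₁`. -/
def rvY₁ (ω : U × V₁ × V₂ × X × Y₁ × Y₂) : Y₁ := ω.2.2.2.2.1
/-- The random variable `Y₂`. -/
def rvY₂ (ω : U × V₁ × V₂ × X × Y₁ × Y₂) : Y₂ := ω.2.2.2.2.2

variable [Fintype U] [Fintype V₁] [Fintype V₂] [Fintype X] [Fintype Y₁] [Fintype Y₂]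

/-- `I(V₁;Y₁|U) - I(V₁;V₂|U) - I(V₁;Y₂|V₂,U)`. -/
noncomputable def bound₁ (P : U × V₁ × V₂ × X × Y₁ × Y₂ → ℝ) : ℝ :=
  condMutualInfo P rvV₁ rvY₁ rvU - condMutualInfo P rvV₁ rvV₂ rvU -
    condMutualInfo P rvV₁ rvY₂ (fun ω => (rvV₂ ω, rvU ω))

/-- `I(V₂;Y₂|U) - I(V₁;V₂|U) - I(V₂;Y₁|V₁,U)`. -/
noncomputable def bound₂ (P : U × V₁ × V₂ × X × Y₁ × Y₂ → ℝ) : ℝ :=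
  condMutualInfo P rvV₂ rvY₂ rvU - condMutualInfo P rvV₁ rvV₂ rvU -
    condMutualInfo P rvV₂ rvY₁ (fun ω => (rvV₁ ω, rvU ω))

end Bounds

end BCCM

/-!
The code is a random double-binning code. Given a block `u` drawn i.i.d. from the law of `U`, each
message `w₁` of the first user owns `J₁` codewords drawn independently from the law of `V₁` given
`u`, and likewise for the second user. The encoder weights the pair of indices `(j₁, j₂)` by
`corr = p(v₁, v₂ | u) / (p(v₁ | u) p(v₂ | u))` divided by `J₁ J₂`, and sends the selected pair of
codewords through `p(x | v₁, v₂)`. Because the codewords of different users are independent given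
`u`, this weight turns the average over codebooks into the exact joint law of the single-letter
problem, so all averages can be computed as if the selected codewords were jointly i.i.d.

* Reliability (`packing`): a threshold decoder for `w₁` alone fails, on average, with weight at most
  `P[density ≤ T] + (M₁ - 1) J₁ / T`. It suffices that the total rate of messages and codewords is
  below `I(V₁; Y₁ | U)`.
* Secrecy and normalization (`covering`): averaging `corr` times the channel to receiver 2 over the
  `J₁` codewords of a message reproduces `p(y₂ | v₂, u)` in `ℓ¹`, as soon as the rate of `J₁` exceeds
  `I(V₁; V₂, Y₂ | U) = I(V₁; V₂ | U) + I(V₁; Y₂ | V₂, U)`. Summing over `y₂` shows that the weights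
  have total mass close to one, so that they can be normalized to a stochastic encoder. Without
  summing, it shows that the output at receiver 2 is nearly independent of `w₁`.

The two rate constraints together give `bound₁`, and exchanging the roles of the users gives
`bound₂`. Both tail probabilities vanish by Chebyshev's inequality (`eventually_iidMean_le`).
A codebook good for both users exists because the means are small (`exists_codebook`). Finally a
joint law of message and output that is `ℓ¹`-close to a product with uniform first factor has
nearly maximal equivocation (`logb_card_sub_condEntropy_le`); no exponential rate is needed, as the
loss is the distance times the logarithm of the number of messages.

A user with rate zero gets a single message, so the packing constraint is void for that user.
-/

set_option linter.unusedSectionVars false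

namespace BCCM

/-! ### Means under i.i.d. sampling from a finite alphabet -/

section IidMean

variable {ι J B : Type*} [Fintype ι] [DecidableEq ι] [Fintype J] [Fintype B]

/-- The mean of `F c` when the letters `c k`, `k : ι`, are drawn independently from `p`. -/
noncomputable def iidMean (p : B → ℝ) (F : (ι → B) → ℝ) : ℝ :=
  ∑ c : ι → B, (∏ k, p (c k)) * F c

theorem sum_prod_apply (f : ι → B → ℝ) : ∑ c : ι → B, ∏ k, f k (c k) = ∏ k, ∑ b, f k b := by
  rw [Finset.prod_univ_sum, Fintype.piFinset_univ]

theorem iidMean_add (p : B → ℝ) (F G : (ι → B) → ℝ) :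
    iidMean p (fun c => F c + G c) = iidMean p F + iidMean p G := by
  simp only [iidMean, mul_add, Finset.sum_add_distrib]

theorem iidMean_const_mul (p : B → ℝ) (x : ℝ) (F : (ι → B) → ℝ) :
    iidMean p (fun c => x * F c) = x * iidMean p F := by
  simp only [iidMean, Finset.mul_sum]
  exact Finset.sum_congr rfl fun c _ => by ring

theorem iidMean_sum {α : Type*} (s : Finset α) (p : B → ℝ) (F : α → (ι → B) → ℝ) :
    iidMean p (fun c => ∑ a ∈ s, F a c) = ∑ a ∈ s, iidMean p (F a) := by
  simp only [iidMean, Finset.mul_sum]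
  exact Finset.sum_comm

theorem iidMean_mono {p : B → ℝ} (hp : ∀ b, 0 ≤ p b) {F G : (ι → B) → ℝ}
    (h : ∀ c, F c ≤ G c) : iidMean p F ≤ iidMean p G :=
  Finset.sum_le_sum fun c _ =>
    mul_le_mul_of_nonneg_left (h c) (Finset.prod_nonneg fun _ _ => hp _)

theorem iidMean_prod (p : B → ℝ) (f : ι → B → ℝ) :
    iidMean p (fun c => ∏ k, f k (c k)) = ∏ k, ∑ b, p b * f k b := by
  simp only [iidMean, ← Finset.prod_mul_distrib]
  exact sum_prod_apply fun k b => p b * f k b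

theorem sum_prod_eq_one {p : B → ℝ} (hp : ∑ b, p b = 1) :
    ∑ c : ι → B, ∏ k, p (c k) = 1 := by
  rw [sum_prod_apply fun _ => p]; simp [hp]

theorem iidMean_const {p : B → ℝ} (hp : ∑ b, p b = 1) (x : ℝ) :
    iidMean p (fun _ : ι → B => x) = x := by
  rw [iidMean, ← Finset.sum_mul, sum_prod_eq_one hp, one_mul]

theorem iidMean_apply {p : B → ℝ} (hp : ∑ b, p b = 1) (k : ι) (f : B → ℝ) :
    iidMean p (fun c => f (c k)) = ∑ b, p b * f b := by
  have h := iidMean_prod p (fun i b => if i = k then f b else 1)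
  simp only [Finset.prod_ite_eq', Finset.mem_univ, if_true] at h
  rw [h, Finset.prod_eq_single k]
  · simp
  · intro i _ hi; simp [hi, hp]
  · simp

theorem iidMean_apply_mul {p : B → ℝ} (hp : ∑ b, p b = 1) {k l : ι} (hkl : k ≠ l)
    (f g : B → ℝ) :
    iidMean p (fun c => f (c k) * g (c l)) = (∑ b, p b * f b) * ∑ b, p b * g b := by
  have h := iidMean_prod p (fun i b => (if i = k then f b else 1) * (if i = l then g b else 1))
  simp only [Finset.prod_mul_distrib, Finset.prod_ite_eq', Finset.mem_univ, if_true] at h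
  rw [h, ← Finset.mul_prod_erase _ _ (Finset.mem_univ k),
    ← Finset.mul_prod_erase _ _ (Finset.mem_erase.2 ⟨hkl.symm, Finset.mem_univ l⟩),
    Finset.prod_eq_one]
  · simp [hkl, hkl.symm]
  · intro i hi
    simp only [Finset.mem_erase, Finset.mem_univ, and_true] at hi
    simp [hi.1, hi.2, hp]

/-- The mean of a function of two different letters. -/
theorem iidMean_apply₂ {p : B → ℝ} (hp : ∑ b, p b = 1) {k l : ι} (hkl : k ≠ l)
    (f : B → B → ℝ) :
    iidMean p (fun c => f (c k) (c l)) = ∑ b, ∑ b', p b * p b' * f b b' := by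
  classical
  have h : ∀ c : ι → B, f (c k) (c l) = ∑ b, (if c k = b then 1 else 0) * f b (c l) := by
    intro c; simp
  simp only [h]
  rw [iidMean_sum]
  refine Finset.sum_congr rfl fun b _ => ?_
  rw [iidMean_apply_mul hp hkl (fun x => if x = b then 1 else 0) (f b)]
  simp [Finset.mul_sum, mul_assoc]

/-- The second moment of a sum of centred i.i.d. terms, taken over a family of distinct
positions. -/
theorem iidMean_sum_sq {p : B → ℝ} (hp : ∑ b, p b = 1) {κ : J → ι}
    (hκ : Function.Injective κ) (f : B → ℝ) (hf : ∑ b, p b * f b = 0) :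
    iidMean p (fun c => (∑ j, f (c (κ j))) ^ 2) = Fintype.card J * ∑ b, p b * f b ^ 2 := by
  classical
  simp only [sq, Finset.sum_mul_sum]
  rw [iidMean_sum]
  simp only [iidMean_sum]
  have h : ∀ i j : J, iidMean p (fun c => f (c (κ i)) * f (c (κ j))) =
      if i = j then ∑ b, p b * (f b * f b) else 0 := by
    intro i j
    split_ifs with hij
    · subst hij; exact iidMean_apply hp (κ i) fun b => f b * f b
    · rw [iidMean_apply_mul hp (fun e => hij (hκ e)), hf, zero_mul]
  simp [h]

theorem iidMean_sub_const_sq {p : B → ℝ} (hp : ∑ b, p b = 1) {κ : J → ι}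
    (hκ : Function.Injective κ) (f : B → ℝ) :
    iidMean p (fun c => (∑ j, f (c (κ j)) - Fintype.card J * ∑ b, p b * f b) ^ 2) ≤
      Fintype.card J * ∑ b, p b * f b ^ 2 := by
  set μ := ∑ b, p b * f b with hμ
  have h1 : ∀ c : ι → B, ∑ j, f (c (κ j)) - Fintype.card J * μ = ∑ j, (f (c (κ j)) - μ) := by
    intro c; simp [Finset.sum_sub_distrib]
  simp only [h1]
  rw [iidMean_sum_sq hp hκ (fun b => f b - μ)]
  · refine mul_le_mul_of_nonneg_left ?_ (Nat.cast_nonneg _)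
    have : ∑ b, p b * (f b - μ) ^ 2 = ∑ b, p b * f b ^ 2 - μ ^ 2 := by
      have : ∀ b, p b * (f b - μ) ^ 2 = p b * f b ^ 2 - 2 * μ * (p b * f b) + μ ^ 2 * p b :=
        fun b => by ring
      simp only [this, Finset.sum_add_distrib, Finset.sum_sub_distrib, ← Finset.mul_sum, hp, ← hμ]
      ring
    rw [this]; nlinarith [sq_nonneg μ]
  · simp only [mul_sub, Finset.sum_sub_distrib, ← Finset.sum_mul, hp, ← hμ]; ring

theorem sq_iidMean_abs_le {p : B → ℝ} (hp0 : ∀ b, 0 ≤ p b) (hp : ∑ b, p b = 1)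
    (F : (ι → B) → ℝ) : iidMean p (fun c => |F c|) ^ 2 ≤ iidMean p (fun c => F c ^ 2) := by
  have := Real.pow_arith_mean_le_arith_mean_pow Finset.univ (fun c : ι → B => ∏ k, p (c k))
    (fun c => |F c|) (fun c _ => Finset.prod_nonneg fun _ _ => hp0 _) (sum_prod_eq_one hp)
    (fun c _ => abs_nonneg _) 2
  simpa [iidMean] using this

/-- Chebyshev's inequality for an i.i.d. sum. -/
theorem iidMean_chebyshev {p : B → ℝ} (hp0 : ∀ b, 0 ≤ p b) (hp : ∑ b, p b = 1) (f : B → ℝ)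
    {δ : ℝ} (hδ : 0 < δ) {E : (ι → B) → Prop} [DecidablePred E]
    (hE : ∀ c, E c → Fintype.card ι * δ ≤ |∑ k, f (c k) - Fintype.card ι * ∑ b, p b * f b|) :
    iidMean p (fun c => if E c then 1 else 0) * (Fintype.card ι * δ ^ 2) ≤
      ∑ b, p b * f b ^ 2 := by
  rcases (Fintype.card ι).eq_zero_or_pos with h0 | h0
  · rw [h0]; simp only [Nat.cast_zero, zero_mul, mul_zero]
    exact Finset.sum_nonneg fun b _ => mul_nonneg (hp0 b) (sq_nonneg _)
  have hN : (0 : ℝ) < Fintype.card ι := by exact_mod_cast h0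
  have h := iidMean_sub_const_sq hp (Function.injective_id (α := ι)) f
  have h2 : iidMean p (fun c => ((Fintype.card ι : ℝ) * δ) ^ 2 * if E c then 1 else 0) ≤
      iidMean p (fun c : ι → B =>
        (∑ j, f (c (id j)) - Fintype.card ι * ∑ b, p b * f b) ^ 2) := by
    refine iidMean_mono hp0 fun c => ?_
    split_ifs with hc
    · rw [mul_one, ← sq_abs (∑ j, f (c (id j)) - _)]
      exact pow_le_pow_left₀ (by positivity) (hE c hc) 2
    · rw [mul_zero]; positivity
  rw [iidMean_const_mul] at h2
  refine le_of_mul_le_mul_left ?_ hN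
  calc _ = ((Fintype.card ι : ℝ) * δ) ^ 2 * iidMean p (fun c => if E c then 1 else 0) := by ring
    _ ≤ _ := h2.trans h

end IidMean

/-- If a mean is at most `β`, some point of positive weight has value at most `β`. -/
theorem exists_pos_le_of_sum_le {α : Type*} [Fintype α] {p F : α → ℝ} {β : ℝ}
    (hp0 : ∀ a, 0 ≤ p a) (hp : ∑ a, p a = 1) (h : ∑ a, p a * F a ≤ β) :
    ∃ a, 0 < p a ∧ F a ≤ β := by
  by_contra! hcon
  have : ∑ a, p a * β < ∑ a, p a * F a := by
    obtain ⟨a, ha⟩ : ∃ a, 0 < p a := by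
      by_contra! h0
      have : ∑ a, p a ≤ 0 := Finset.sum_nonpos fun a _ => h0 a
      linarith
    refine Finset.sum_lt_sum (fun b _ => ?_)
      ⟨a, Finset.mem_univ a, mul_lt_mul_of_pos_left (hcon a ha) ha⟩
    rcases (hp0 b).eq_or_lt with hb | hb
    · rw [← hb]; simp
    · exact mul_le_mul_of_nonneg_left (hcon b hb).le hb.le
  rw [← Finset.sum_mul, hp, one_mul] at this
  linarith

/-! ### Packing and covering for one use of the channel -/

section OneShot

variable {B C D : Type*} [Fintype B] [Fintype C] [Fintype D]

/-- The marginal of the first letter of a pair with law `q`. The marginal of the second letter is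
`marg (flip q)`. -/
noncomputable def marg (q : B → C → ℝ) (b : B) : ℝ := ∑ c, q b c

/-- The density of the pair law `q` with respect to the product of its marginals; it is `0` where
one of the marginals vanishes. -/
noncomputable def corr (q : B → C → ℝ) (b : B) (c : C) : ℝ :=
  q b c / (marg q b * marg (flip q) c)

/-- The joint law of the first letter and the output, for a pair with law `q` sent through `K`. -/
noncomputable def outJoint (q : B → C → ℝ) (K : B → C → D → ℝ) (b : B) (d : D) : ℝ :=
  ∑ c, q b c * K b c d

/-- The law of the output, for a pair with law `q` sent through `K`. -/
noncomputable def outMarg (q : B → C → ℝ) (K : B → C → D → ℝ) (d : D) : ℝ :=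
  ∑ b, outJoint q K b d

/-- The conditional law of the output given the second letter, for a pair with law `q` sent
through `K`; it is `0` where the second marginal vanishes. -/
noncomputable def outCond (q : B → C → ℝ) (K : B → C → D → ℝ) (c : C) (d : D) : ℝ :=
  ∑ b, marg q b * (corr q b c * K b c d)

theorem corr_flip (q : B → C → ℝ) (b : B) (c : C) : corr (flip q) c b = corr q b c := by
  simp only [corr]
  rw [mul_comm]
  rfl

variable {q : B → C → ℝ} {K : B → C → D → ℝ}

theorem marg_nonneg (hq : ∀ b c, 0 ≤ q b c) (b : B) : 0 ≤ marg q b :=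
  Finset.sum_nonneg fun c _ => hq b c

theorem le_marg (hq : ∀ b c, 0 ≤ q b c) (b : B) (c : C) : q b c ≤ marg q b :=
  Finset.single_le_sum (f := fun c => q b c) (fun c _ => hq b c) (Finset.mem_univ c)

theorem sum_marg (h1 : ∑ b, ∑ c, q b c = 1) : ∑ b, marg q b = 1 := h1

theorem sum_marg_flip (h1 : ∑ b, ∑ c, q b c = 1) : ∑ c, marg (flip q) c = 1 := by
  rw [← h1, Finset.sum_comm]; rfl

theorem corr_nonneg (hq : ∀ b c, 0 ≤ q b c) (b : B) (c : C) : 0 ≤ corr q b c :=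
  div_nonneg (hq b c) (mul_nonneg (marg_nonneg hq b) (marg_nonneg (fun _ _ => hq _ _) c))

/-- Weighting independent letters by `corr q` gives back the joint law `q`, also where a marginal
vanishes. -/
theorem marg_mul_corr (hq : ∀ b c, 0 ≤ q b c) (b : B) (c : C) :
    marg q b * (marg (flip q) c * corr q b c) = q b c := by
  have hb := le_marg hq b c
  have hc := le_marg (q := flip q) (fun _ _ => hq _ _) c b
  change q b c ≤ _ at hc
  rw [← mul_assoc, corr]
  rcases eq_or_ne (marg q b * marg (flip q) c) 0 with h | h
  · rw [h, zero_mul]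
    rcases mul_eq_zero.1 h with h | h
    · exact le_antisymm (hq b c) (h ▸ hb)
    · exact le_antisymm (hq b c) (h ▸ hc)
  · exact mul_div_cancel₀ _ h

theorem outJoint_nonneg (hq : ∀ b c, 0 ≤ q b c) (hK : ∀ b c d, 0 ≤ K b c d) (b : B) (d : D) :
    0 ≤ outJoint q K b d :=
  Finset.sum_nonneg fun c _ => mul_nonneg (hq b c) (hK b c d)

theorem outCond_nonneg (hq : ∀ b c, 0 ≤ q b c) (hK : ∀ b c d, 0 ≤ K b c d) (c : C) (d : D) :
    0 ≤ outCond q K c d :=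
  Finset.sum_nonneg fun b _ =>
    mul_nonneg (marg_nonneg hq b) (mul_nonneg (corr_nonneg hq b c) (hK b c d))

theorem sum_outCond (hq : ∀ b c, 0 ≤ q b c) (hK1 : ∀ b c, ∑ d, K b c d = 1) {c : C}
    (hc : 0 < marg (flip q) c) : ∑ d, outCond q K c d = 1 := by
  have h : marg (flip q) c * ∑ d, outCond q K c d = marg (flip q) c := by
    simp only [outCond]
    rw [Finset.sum_comm]
    simp only [← Finset.mul_sum, hK1, mul_one]
    rw [Finset.mul_sum]
    exact Finset.sum_congr rfl fun b _ => by
      rw [mul_left_comm, marg_mul_corr hq]; rfl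
  exact mul_left_cancel₀ hc.ne' (h.trans (mul_one _).symm)

section Packing

variable {M J L : Type*} [Fintype M] [Fintype J] [Fintype L] [DecidableEq M] [DecidableEq J]
  [DecidableEq L]

open Classical in
/-- The decoder that looks for a message one of whose codewords passes the test `G` against the
received letter. -/
noncomputable def testDecoder [Nonempty M] (G : B → D → Prop) (c : M × J → B) (d : D) : M :=
  if h : ∃ w j, G (c (w, j)) d then h.choose else Classical.arbitrary M

open Classical in
/-- The test decoder errs only if the transmitted codeword fails the test or a codeword of another
message passes it; other codewords of the same message do no harm. -/
theorem testDecoder_error_le [Nonempty M] (G : B → D → Prop) (c : M × J → B) (d : D) (k : M × J) :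
    (if testDecoder G c d ≠ k.1 then (1 : ℝ) else 0) ≤
      (if ¬ G (c k) d then 1 else 0) +
        ∑ l : M × J with l.1 ≠ k.1, if G (c l) d then 1 else 0 := by
  have hnn : (0 : ℝ) ≤ ∑ l : M × J with l.1 ≠ k.1, if G (c l) d then (1 : ℝ) else 0 :=
    Finset.sum_nonneg fun l _ => by split_ifs <;> norm_num
  by_cases hG : G (c k) d
  · have hex : ∃ w j, G (c (w, j)) d := ⟨k.1, k.2, hG⟩
    obtain ⟨j, hj⟩ := hex.choose_spec
    have hdec : testDecoder G c d = hex.choose := dif_pos hex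
    split_ifs with hne
    · rw [zero_add]
      refine le_trans ?_ (Finset.single_le_sum (f := fun l => if G (c l) d then (1 : ℝ) else 0)
        (fun l _ => by split_ifs <;> norm_num)
        (Finset.mem_filter.2 ⟨Finset.mem_univ (testDecoder G c d, j), hne⟩))
      rw [if_pos (by rw [hdec]; exact hj)]
    · simp
  · rw [if_pos hG]
    split_ifs <;> linarith

theorem sum_marg_mul_outMarg_test_le (hq : ∀ b c, 0 ≤ q b c) (h1 : ∑ b, ∑ c, q b c = 1)
    (hK : ∀ b c d, 0 ≤ K b c d) (hK1 : ∀ b c, ∑ d, K b c d = 1) {T : ℝ} (hT : 0 < T)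
    (G : B → D → Prop) [∀ b d, Decidable (G b d)]
    (hG : ∀ b d, G b d → T * (marg q b * outMarg q K d) ≤ outJoint q K b d) :
    ∑ b, ∑ d, marg q b * outMarg q K d * (if G b d then 1 else 0) ≤ 1 / T := by
  have h2 : ∑ b, ∑ d, outJoint q K b d = 1 := by
    rw [← h1]
    refine Finset.sum_congr rfl fun b _ => ?_
    simp only [outJoint]
    rw [Finset.sum_comm]
    simp [← Finset.mul_sum, hK1]
  rw [show 1 / T = (∑ b, ∑ d, outJoint q K b d) / T by rw [h2], Finset.sum_div]
  refine Finset.sum_le_sum fun b _ => ?_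
  rw [Finset.sum_div]
  refine Finset.sum_le_sum fun d _ => ?_
  split_ifs with h
  · rw [mul_one, le_div_iff₀ hT, mul_comm]; exact hG b d h
  · rw [mul_zero]; exact div_nonneg (outJoint_nonneg hq hK b d) hT.le

open Classical in
/-- **Packing.** When the encoder weights the codeword pairs by `corr q`, the mean weight of a
decoding error is the probability that the transmitted codeword fails the test, plus a union bound
over the codewords of the other messages. -/
theorem packing [Nonempty M] (hq : ∀ b c, 0 ≤ q b c) (h1 : ∑ b, ∑ c, q b c = 1)
    (hK : ∀ b c d, 0 ≤ K b c d) (hK1 : ∀ b c, ∑ d, K b c d = 1) {T : ℝ} (hT : 0 < T)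
    (G : B → D → Prop) (hG : ∀ b d, G b d → T * (marg q b * outMarg q K d) ≤ outJoint q K b d)
    (k : M × J) (l : L) :
    iidMean (marg q) (fun c₁ : M × J → B => iidMean (marg (flip q)) fun c₂ : L → C =>
      corr q (c₁ k) (c₂ l) * ∑ d with testDecoder G c₁ d ≠ k.1, K (c₁ k) (c₂ l) d) ≤
    (∑ b, ∑ c, ∑ d, q b c * K b c d * (if ¬ G b d then 1 else 0)) +
      ((Fintype.card M - 1) * Fintype.card J) / T := by
  have hm := sum_marg h1
  have hm' := sum_marg_flip h1
  have hmn := marg_nonneg hq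
  have hmn' : ∀ c, 0 ≤ marg (flip q) c := marg_nonneg fun _ _ => hq _ _
  set f : B → ℝ := fun b => ∑ c, marg (flip q) c * (corr q b c *
    ∑ d, K b c d * (if ¬ G b d then 1 else 0)) with hf
  set h : B → B → ℝ := fun b b' => ∑ c, marg (flip q) c * (corr q b c *
    ∑ d, K b c d * (if G b' d then 1 else 0)) with hh
  have step : iidMean (marg q) (fun c₁ : M × J → B => iidMean (marg (flip q)) fun c₂ : L → C =>
      corr q (c₁ k) (c₂ l) * ∑ d with testDecoder G c₁ d ≠ k.1, K (c₁ k) (c₂ l) d) ≤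
      iidMean (marg q) (fun c₁ : M × J → B => f (c₁ k) +
        ∑ i : M × J with i.1 ≠ k.1, h (c₁ k) (c₁ i)) := by
    refine iidMean_mono hmn fun c₁ => ?_
    rw [iidMean_apply hm' l fun c => corr q (c₁ k) c *
      ∑ d with testDecoder G c₁ d ≠ k.1, K (c₁ k) c d]
    simp only [hf, hh]
    rw [Finset.sum_comm, ← Finset.sum_add_distrib]
    refine Finset.sum_le_sum fun c _ => ?_
    rw [← Finset.mul_sum, ← mul_add, ← Finset.mul_sum, ← mul_add]
    refine mul_le_mul_of_nonneg_left (mul_le_mul_of_nonneg_left ?_ (corr_nonneg hq _ _)) (hmn' c)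
    rw [Finset.sum_comm, ← Finset.sum_add_distrib, Finset.sum_filter]
    refine Finset.sum_le_sum fun d _ => ?_
    rw [← Finset.mul_sum, ← mul_add]
    refine le_trans (le_of_eq ?_)
      (mul_le_mul_of_nonneg_left (testDecoder_error_le G c₁ d k) (hK (c₁ k) c d))
    rw [mul_ite, mul_one, mul_zero]
  refine step.trans ?_
  rw [iidMean_add, iidMean_sum _ _ fun i c₁ => h (c₁ k) (c₁ i), iidMean_apply hm k f]
  refine add_le_add (le_of_eq ?_) ?_
  · refine Finset.sum_congr rfl fun b _ => ?_
    rw [hf, Finset.mul_sum]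
    refine Finset.sum_congr rfl fun c _ => ?_
    simp only [Finset.mul_sum]
    refine Finset.sum_congr rfl fun d _ => ?_
    linear_combination (K b c d * (if ¬ G b d then 1 else 0)) * marg_mul_corr hq b c
  · have hpair : ∀ i : M × J, i.1 ≠ k.1 →
        iidMean (marg q) (fun c₁ : M × J → B => h (c₁ k) (c₁ i)) ≤ 1 / T := by
      intro i hi
      have hki : k ≠ i := fun e => hi (by rw [e])
      rw [iidMean_apply₂ hm hki]
      refine le_trans (le_of_eq ?_) (sum_marg_mul_outMarg_test_le hq h1 hK hK1 hT G hG)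
      rw [Finset.sum_comm]
      refine Finset.sum_congr rfl fun b' _ => ?_
      simp only [hh, outMarg, outJoint, Finset.mul_sum, Finset.sum_mul]
      conv_rhs => rw [Finset.sum_comm]
      refine Finset.sum_congr rfl fun b _ => ?_
      conv_rhs => rw [Finset.sum_comm]
      refine Finset.sum_congr rfl fun c _ => Finset.sum_congr rfl fun d _ => ?_
      linear_combination (marg q b' * K b c d * (if G b' d then 1 else 0)) * marg_mul_corr hq b c
    refine (Finset.sum_le_sum fun i hi => hpair i (Finset.mem_filter.1 hi).2).trans ?_
    rw [Finset.sum_const, nsmul_eq_mul, mul_one_div]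
    refine div_le_div_of_nonneg_right (le_of_eq ?_) hT.le
    have hcard : (Finset.univ.filter fun i : M × J => i.1 ≠ k.1) =
        (Finset.univ.erase k.1) ×ˢ (Finset.univ : Finset J) := by
      ext i; simp
    rw [hcard, Finset.card_product, Finset.card_erase_of_mem (Finset.mem_univ _),
      Nat.cast_mul, Nat.cast_sub (Finset.card_pos.2 ⟨k.1, Finset.mem_univ _⟩)]
    simp

end Packing

section Covering

variable {ι J : Type*} [Fintype ι] [DecidableEq ι] [Fintype J]

/-- Soft covering at one output letter: the empirical mean of `g` over `J` independent samples is
close to its expectation `m`, up to the contribution of the event `S * m < g`. -/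
theorem soft_covering_point [Nonempty J] {p : B → ℝ} (hp0 : ∀ b, 0 ≤ p b) (hp : ∑ b, p b = 1)
    {g : B → ℝ} (hg : ∀ b, 0 ≤ g b) {m S θ : ℝ} (hm : ∑ b, p b * g b = m) (hS : 0 ≤ S)
    (hθ : 0 ≤ θ) (hSθ : S ≤ θ ^ 2 * Fintype.card J) {κ : J → ι} (hκ : Function.Injective κ) :
    iidMean p (fun c => |1 / Fintype.card J * ∑ j, g (c (κ j)) - m|) ≤
      2 * ∑ b, p b * (if S * m < g b then g b else 0) + θ * m := by
  have hN : (0 : ℝ) < Fintype.card J := by exact_mod_cast Fintype.card_pos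
  set g₂ : B → ℝ := fun b => if S * m < g b then g b else 0 with hg₂
  set g₁ : B → ℝ := fun b => g b - g₂ b with hg₁
  have hm0 : 0 ≤ m := hm ▸ Finset.sum_nonneg fun b _ => mul_nonneg (hp0 b) (hg b)
  have hg₂0 : ∀ b, 0 ≤ g₂ b := fun b => by
    simp only [hg₂]; split_ifs; exacts [hg b, le_rfl]
  have hg₁0 : ∀ b, 0 ≤ g₁ b := fun b => by
    simp only [hg₁, hg₂]; split_ifs; exacts [(sub_self (g b)).ge, by simpa using hg b]
  have hg₁S : ∀ b, g₁ b ≤ S * m := fun b => by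
    simp only [hg₁, hg₂]; split_ifs with h
    · rw [sub_self]; positivity
    · rw [sub_zero]; exact not_lt.1 h
  have hg₁g : ∀ b, g₁ b ≤ g b := fun b => sub_le_self _ (hg₂0 b)
  set m₁ := ∑ b, p b * g₁ b with hm₁
  set m₂ := ∑ b, p b * g₂ b with hm₂
  have hm₂0 : 0 ≤ m₂ := Finset.sum_nonneg fun b _ => mul_nonneg (hp0 b) (hg₂0 b)
  have hm12 : m = m₁ + m₂ := by
    rw [← hm, hm₁, hm₂, ← Finset.sum_add_distrib]
    exact Finset.sum_congr rfl fun b _ => by simp only [hg₁]; ring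
  -- the truncated part concentrates, by a second moment bound
  have hvar : iidMean p (fun c : ι → B => |∑ j, g₁ (c (κ j)) - Fintype.card J * m₁|) ≤
      Fintype.card J * (θ * m) := by
    refine abs_le_of_sq_le_sq' ?_ (by positivity) |>.2
    refine (sq_iidMean_abs_le hp0 hp _).trans ((iidMean_sub_const_sq hp hκ g₁).trans ?_)
    have : ∑ b, p b * g₁ b ^ 2 ≤ S * m * m := by
      rw [← hm, Finset.mul_sum, hm]
      refine Finset.sum_le_sum fun b _ => ?_
      have := mul_le_mul (hg₁S b) (hg₁g b) (hg₁0 b) (by positivity)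
      nlinarith [hp0 b]
    calc (Fintype.card J : ℝ) * ∑ b, p b * g₁ b ^ 2
        ≤ Fintype.card J * (S * m * m) := by gcongr
      _ ≤ Fintype.card J * (θ ^ 2 * Fintype.card J * m * m) := by gcongr
      _ = _ := by ring
  have hpt : ∀ c : ι → B, |1 / Fintype.card J * ∑ j, g (c (κ j)) - m| ≤
      1 / Fintype.card J * |∑ j, g₁ (c (κ j)) - Fintype.card J * m₁| +
        (1 / Fintype.card J * ∑ j, g₂ (c (κ j)) + m₂) := by
    intro c
    have e : 1 / Fintype.card J * ∑ j, g (c (κ j)) - m =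
        1 / Fintype.card J * (∑ j, g₁ (c (κ j)) - Fintype.card J * m₁) +
          (1 / Fintype.card J * ∑ j, g₂ (c (κ j)) - m₂) := by
      have : ∑ j, g (c (κ j)) = ∑ j, g₁ (c (κ j)) + ∑ j, g₂ (c (κ j)) := by
        rw [← Finset.sum_add_distrib]
        exact Finset.sum_congr rfl fun j _ => by simp only [hg₁]; ring
      rw [this, hm12]; field_simp; ring
    rw [e]
    have hs : 0 ≤ 1 / (Fintype.card J : ℝ) * ∑ j, g₂ (c (κ j)) :=
      mul_nonneg (by positivity) (Finset.sum_nonneg fun j _ => hg₂0 _)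
    refine (abs_add_le _ _).trans (add_le_add (le_of_eq ?_) ?_)
    · rw [abs_mul, abs_of_nonneg (by positivity)]
    · rw [abs_le]; constructor <;> linarith
  refine (iidMean_mono hp0 hpt).trans ?_
  rw [iidMean_add, iidMean_add, iidMean_const hp, iidMean_const_mul, iidMean_const_mul,
    iidMean_sum]
  simp only [iidMean_apply hp, Finset.sum_const, Finset.card_univ, nsmul_eq_mul, ← hm₂]
  calc _ ≤ 1 / (Fintype.card J : ℝ) * (Fintype.card J * (θ * m)) +
        (1 / Fintype.card J * (Fintype.card J * m₂) + m₂) := by gcongr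
    _ = _ := by field_simp; ring

open Classical in
/-- **Soft covering.** Averaging the weights `corr q` times the channel over sufficiently many
independent codewords of the first user nearly reproduces the conditional law of the output given
the codeword of the second user. -/
theorem covering [Nonempty J] {L : Type*} [Fintype L] [DecidableEq L]
    (hq : ∀ b c, 0 ≤ q b c) (h1 : ∑ b, ∑ c, q b c = 1)
    (hK : ∀ b c d, 0 ≤ K b c d) (hK1 : ∀ b c, ∑ d, K b c d = 1) {S θ : ℝ} (hS : 0 ≤ S)
    (hθ : 0 ≤ θ) (hSθ : S ≤ θ ^ 2 * Fintype.card J) {κ : J → ι} (hκ : Function.Injective κ)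
    (l : L) :
    iidMean (marg q) (fun c₁ : ι → B => iidMean (marg (flip q)) fun c₂ : L → C =>
      ∑ d, |1 / Fintype.card J * ∑ j, corr q (c₁ (κ j)) (c₂ l) * K (c₁ (κ j)) (c₂ l) d -
        outCond q K (c₂ l) d|) ≤
    2 * (∑ b, ∑ c, ∑ d, q b c * K b c d *
      (if S * outCond q K c d < corr q b c * K b c d then 1 else 0)) + θ := by
  have hm := sum_marg h1
  have hm' := sum_marg_flip h1
  have hmn := marg_nonneg hq
  have hmn' : ∀ c, 0 ≤ marg (flip q) c := marg_nonneg fun _ _ => hq _ _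
  have step : ∀ c₁ : ι → B, iidMean (marg (flip q)) (fun c₂ : L → C =>
      ∑ d, |1 / Fintype.card J * ∑ j, corr q (c₁ (κ j)) (c₂ l) * K (c₁ (κ j)) (c₂ l) d -
        outCond q K (c₂ l) d|) = ∑ c, ∑ d, marg (flip q) c *
        |1 / Fintype.card J * ∑ j, corr q (c₁ (κ j)) c * K (c₁ (κ j)) c d -
          outCond q K c d| := by
    intro c₁
    rw [iidMean_apply hm' l fun c => ∑ d, |1 / Fintype.card J *
      ∑ j, corr q (c₁ (κ j)) c * K (c₁ (κ j)) c d - outCond q K c d|]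
    simp only [Finset.mul_sum]
  simp only [step]
  rw [iidMean_sum]
  simp only [iidMean_sum, iidMean_const_mul]
  have hpt : ∀ c d, iidMean (marg q) (fun c₁ : ι → B => |1 / Fintype.card J *
      ∑ j, corr q (c₁ (κ j)) c * K (c₁ (κ j)) c d - outCond q K c d|) ≤
      2 * ∑ b, marg q b * (if S * outCond q K c d < corr q b c * K b c d
        then corr q b c * K b c d else 0) + θ * outCond q K c d := fun c d =>
    soft_covering_point hmn hm (g := fun b => corr q b c * K b c d)
      (fun b => mul_nonneg (corr_nonneg hq b c) (hK b c d)) rfl hS hθ hSθ hκ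
  refine (Finset.sum_le_sum fun c _ => Finset.sum_le_sum fun d _ =>
    mul_le_mul_of_nonneg_left (hpt c d) (hmn' c)).trans ?_
  simp only [mul_add, Finset.sum_add_distrib]
  refine add_le_add (le_of_eq ?_) ?_
  · rw [Finset.sum_comm (γ := B) (α := C), Finset.mul_sum]
    refine Finset.sum_congr rfl fun c _ => ?_
    rw [Finset.sum_comm (γ := B) (α := D), Finset.mul_sum]
    refine Finset.sum_congr rfl fun d _ => ?_
    simp only [Finset.mul_sum]
    refine Finset.sum_congr rfl fun b _ => ?_
    split_ifs
    · linear_combination (2 * K b c d) * marg_mul_corr hq b c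
    · ring
  · have : ∀ c, ∑ d, marg (flip q) c * (θ * outCond q K c d) ≤ marg (flip q) c * θ := by
      intro c
      rw [← Finset.mul_sum, ← Finset.mul_sum]
      rcases (hmn' c).eq_or_lt with h | h
      · rw [← h]; simp
      · rw [sum_outCond hq hK1 h, mul_one]
    refine (Finset.sum_le_sum fun c _ => this c).trans (le_of_eq ?_)
    rw [← Finset.sum_mul, hm', one_mul]

end Covering

end OneShot

/-! ### Random codebooks and the encoder derived from them -/

section Codebook

variable {B C D : Type*} [Fintype B] [Fintype C] [Fintype D]
  {M₁ M₂ J₁ J₂ : Type*} [Fintype M₁] [Fintype M₂] [Fintype J₁] [Fintype J₂]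

/-- The average weight of a decoding error at the receiver of the first user, when the pair of
codewords is weighted by `corr q` instead of being drawn from a probability distribution. -/
noncomputable def packErr [DecidableEq M₁] (q : B → C → ℝ) (K : B → C → D → ℝ) (φ : D → M₁)
    (c₁ : M₁ × J₁ → B) (c₂ : M₂ × J₂ → C) : ℝ :=
  1 / ((Fintype.card M₁ : ℝ) * Fintype.card M₂) * ∑ w₁, ∑ w₂,
    1 / ((Fintype.card J₁ : ℝ) * Fintype.card J₂) * ∑ j₁, ∑ j₂,
      corr q (c₁ (w₁, j₁)) (c₂ (w₂, j₂)) *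
        ∑ d with φ d ≠ w₁, K (c₁ (w₁, j₁)) (c₂ (w₂, j₂)) d

/-- The average `ℓ¹` distance between the output weights obtained by averaging over the codewords
`j₁` of a message of the first user, and the conditional law of the output given the codeword of
the second user. -/
noncomputable def covErr (q : B → C → ℝ) (K : B → C → D → ℝ)
    (c₁ : M₁ × J₁ → B) (c₂ : M₂ × J₂ → C) : ℝ :=
  1 / ((Fintype.card M₁ : ℝ) * Fintype.card M₂) * ∑ w₁, ∑ w₂,
    1 / (Fintype.card J₂ : ℝ) * ∑ j₂, ∑ d,
      |1 / (Fintype.card J₁ : ℝ) * ∑ j₁, corr q (c₁ (w₁, j₁)) (c₂ (w₂, j₂)) *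
        K (c₁ (w₁, j₁)) (c₂ (w₂, j₂)) d - outCond q K (c₂ (w₂, j₂)) d|

open Classical in
/-- The probability that the codeword of the first user fails the threshold test. -/
noncomputable def packTail (q : B → C → ℝ) (K : B → C → D → ℝ) (T : ℝ) : ℝ :=
  ∑ b, ∑ c, ∑ d, q b c * K b c d *
    (if outJoint q K b d ≤ T * (marg q b * outMarg q K d) then 1 else 0)

open Classical in
/-- The probability that the density of the law of the first letter given the second letter and
the output, with respect to its marginal law, exceeds `S`. -/
noncomputable def covTail (q : B → C → ℝ) (K : B → C → D → ℝ) (S : ℝ) : ℝ :=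
  ∑ b, ∑ c, ∑ d, q b c * K b c d *
    (if S * outCond q K c d < corr q b c * K b c d then 1 else 0)

theorem avg_le [Nonempty M₁] {f : M₁ → ℝ} {β : ℝ} (h : ∀ i, f i ≤ β) :
    1 / (Fintype.card M₁ : ℝ) * ∑ i, f i ≤ β := by
  have h0 : (0 : ℝ) < Fintype.card M₁ := by exact_mod_cast Fintype.card_pos
  rw [one_div, inv_mul_le_iff₀ h0]
  refine (Finset.sum_le_sum fun i _ => h i).trans (le_of_eq ?_)
  simp

theorem avg₂_le [Nonempty M₁] [Nonempty M₂] {f : M₁ → M₂ → ℝ} {β : ℝ} (h : ∀ i j, f i j ≤ β) :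
    1 / ((Fintype.card M₁ : ℝ) * Fintype.card M₂) * ∑ i, ∑ j, f i j ≤ β := by
  rw [← one_div_mul_one_div, mul_assoc, Finset.mul_sum]
  exact avg_le fun i => avg_le (h i)

section Mean

variable [DecidableEq M₁] [DecidableEq M₂] [DecidableEq J₁] [DecidableEq J₂]

/-- The mean over independent codebooks of the two users. -/
noncomputable def bookMean (q : B → C → ℝ) (F : (M₁ × J₁ → B) → (M₂ × J₂ → C) → ℝ) : ℝ :=
  iidMean (marg q) fun c₁ => iidMean (marg (flip q)) fun c₂ => F c₁ c₂

theorem bookMean_flip (q : B → C → ℝ) (F : (M₁ × J₁ → B) → (M₂ × J₂ → C) → ℝ) :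
    bookMean (flip q) (fun c₂ c₁ => F c₁ c₂) = bookMean q F := by
  simp only [bookMean, iidMean, Finset.mul_sum]
  rw [Finset.sum_comm]
  refine Finset.sum_congr rfl fun c₁ _ => Finset.sum_congr rfl fun c₂ _ => ?_
  rw [mul_left_comm]; rfl

theorem bookMean_add (q : B → C → ℝ) (F G : (M₁ × J₁ → B) → (M₂ × J₂ → C) → ℝ) :
    bookMean q (fun c₁ c₂ => F c₁ c₂ + G c₁ c₂) = bookMean q F + bookMean q G := by
  simp only [bookMean, iidMean_add]

variable [Nonempty M₁] [Nonempty M₂] [Nonempty J₁] [Nonempty J₂]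
  {q : B → C → ℝ} {K : B → C → D → ℝ}

theorem bookMean_packErr_le (hq : ∀ b c, 0 ≤ q b c) (h1 : ∑ b, ∑ c, q b c = 1)
    (hK : ∀ b c d, 0 ≤ K b c d) (hK1 : ∀ b c, ∑ d, K b c d = 1) {T : ℝ} (hT : 0 < T) :
    bookMean q (fun (c₁ : M₁ × J₁ → B) (c₂ : M₂ × J₂ → C) => packErr q K
      (testDecoder (fun b d => T * (marg q b * outMarg q K d) < outJoint q K b d) c₁) c₁ c₂) ≤
    packTail q K T + ((Fintype.card M₁ - 1) * Fintype.card J₁) / T := by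
  simp only [bookMean, packErr, iidMean_const_mul, iidMean_sum]
  refine avg₂_le fun w₁ w₂ => avg₂_le fun j₁ j₂ => ?_
  have := packing hq h1 hK hK1 hT
    (fun b d => T * (marg q b * outMarg q K d) < outJoint q K b d) (fun b d h => h.le)
    (w₁, j₁) (w₂, j₂)
  simp only [not_lt] at this
  refine le_trans (le_of_eq ?_) (this.trans (le_of_eq ?_))
  · congr!
  · rfl

theorem bookMean_covErr_le (hq : ∀ b c, 0 ≤ q b c) (h1 : ∑ b, ∑ c, q b c = 1)
    (hK : ∀ b c d, 0 ≤ K b c d) (hK1 : ∀ b c, ∑ d, K b c d = 1) {S θ : ℝ} (hS : 0 ≤ S)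
    (hθ : 0 ≤ θ) (hSθ : S ≤ θ ^ 2 * Fintype.card J₁) :
    bookMean q (fun (c₁ : M₁ × J₁ → B) (c₂ : M₂ × J₂ → C) => covErr q K c₁ c₂) ≤
    2 * covTail q K S + θ := by
  simp only [bookMean, covErr, iidMean_const_mul, iidMean_sum (Finset.univ (α := M₁)),
    iidMean_sum (Finset.univ (α := M₂)), iidMean_sum (Finset.univ (α := J₂))]
  exact avg₂_le fun w₁ w₂ => avg_le fun j₂ => covering hq h1 hK hK1 hS hθ hSθ
    (κ := fun j => (w₁, j)) (fun _ _ h => (Prod.ext_iff.1 h).2) (w₂, j₂)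

/-- There is a codebook that is good for all four criteria at once: reliability of both users, and
secrecy of each message at the receiver of the other one. -/
theorem exists_codebook {A D₁ D₂ : Type*} [Fintype A] [Fintype D₁] [Fintype D₂] {pA : A → ℝ}
    (hA : ∀ a, 0 ≤ pA a) (hA1 : ∑ a, pA a = 1) {q : A → B → C → ℝ}
    (hq : ∀ a b c, 0 ≤ q a b c) (h1 : ∀ a, ∑ b, ∑ c, q a b c = 1)
    {K₁ : B → C → D₁ → ℝ} (hK₁ : ∀ b c d, 0 ≤ K₁ b c d) (hK₁1 : ∀ b c, ∑ d, K₁ b c d = 1)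
    {K₂ : B → C → D₂ → ℝ} (hK₂ : ∀ b c d, 0 ≤ K₂ b c d) (hK₂1 : ∀ b c, ∑ d, K₂ b c d = 1)
    {T₁ T₂ S₁ S₂ ε : ℝ} (hT₁ : 0 < T₁) (hT₂ : 0 < T₂) (hS₁ : 0 ≤ S₁) (hS₂ : 0 ≤ S₂) (hε : 0 ≤ ε)
    (hJ₁ : S₁ ≤ ε ^ 2 * Fintype.card J₁) (hJ₂ : S₂ ≤ ε ^ 2 * Fintype.card J₂)
    (hM₁ : ((Fintype.card M₁ - 1) * Fintype.card J₁) / T₁ ≤ ε)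
    (hM₂ : ((Fintype.card M₂ - 1) * Fintype.card J₂) / T₂ ≤ ε)
    (hp₁ : ∑ a, pA a * packTail (q a) K₁ T₁ ≤ ε)
    (hp₂ : ∑ a, pA a * packTail (flip (q a)) (fun c b => K₂ b c) T₂ ≤ ε)
    (hc₁ : ∑ a, pA a * covTail (q a) K₂ S₁ ≤ ε)
    (hc₂ : ∑ a, pA a * covTail (flip (q a)) (fun c b => K₁ b c) S₂ ≤ ε) :
    ∃ (a : A) (c₁ : M₁ × J₁ → B) (c₂ : M₂ × J₂ → C) (φ₁ : D₁ → M₁) (φ₂ : D₂ → M₂),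
      (∀ l, 0 < marg (flip (q a)) (c₂ l)) ∧
      packErr (q a) K₁ φ₁ c₁ c₂ + packErr (flip (q a)) (fun c b => K₂ b c) φ₂ c₂ c₁ +
        (covErr (q a) K₂ c₁ c₂ + covErr (flip (q a)) (fun c b => K₁ b c) c₂ c₁) ≤ 10 * ε := by
  set φ₁ : A → (M₁ × J₁ → B) → D₁ → M₁ := fun a => testDecoder fun b d =>
    T₁ * (marg (q a) b * outMarg (q a) K₁ d) < outJoint (q a) K₁ b d
  set φ₂ : A → (M₂ × J₂ → C) → D₂ → M₂ := fun a => testDecoder fun c d =>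
    T₂ * (marg (flip (q a)) c * outMarg (flip (q a)) (fun c b => K₂ b c) d) <
      outJoint (flip (q a)) (fun c b => K₂ b c) c d
  have h1' : ∀ a, ∑ c, ∑ b, flip (q a) c b = 1 := fun a => by
    rw [← h1 a, Finset.sum_comm]; rfl
  set F : A → (M₁ × J₁ → B) → (M₂ × J₂ → C) → ℝ := fun a c₁ c₂ =>
    packErr (q a) K₁ (φ₁ a c₁) c₁ c₂ + packErr (flip (q a)) (fun c b => K₂ b c) (φ₂ a c₂) c₂ c₁ +
      (covErr (q a) K₂ c₁ c₂ + covErr (flip (q a)) (fun c b => K₁ b c) c₂ c₁) with hF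
  have hmean : ∀ a, bookMean (q a) (F a) ≤
      packTail (q a) K₁ T₁ + packTail (flip (q a)) (fun c b => K₂ b c) T₂ +
        2 * covTail (q a) K₂ S₁ + 2 * covTail (flip (q a)) (fun c b => K₁ b c) S₂ + 4 * ε := by
    intro a
    have e₁ := bookMean_packErr_le (M₂ := M₂) (J₂ := J₂) (hq a) (h1 a) hK₁ hK₁1 hT₁ (M₁ := M₁)
      (J₁ := J₁)
    have e₂ := bookMean_packErr_le (M₂ := M₁) (J₂ := J₁) (q := flip (q a)) (fun c b => hq a b c)
      (h1' a) (K := fun c b => K₂ b c) (fun c b => hK₂ b c) (fun c b => hK₂1 b c) hT₂ (M₁ := M₂)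
      (J₁ := J₂)
    have e₃ := bookMean_covErr_le (M₁ := M₁) (M₂ := M₂) (J₂ := J₂) (hq a) (h1 a) hK₂ hK₂1
      hS₁ hε hJ₁
    have e₄ := bookMean_covErr_le (M₁ := M₂) (M₂ := M₁) (J₂ := J₁) (q := flip (q a))
      (fun c b => hq a b c) (h1' a) (K := fun c b => K₁ b c) (fun c b => hK₁ b c)
      (fun c b => hK₁1 b c) hS₂ hε hJ₂
    rw [← bookMean_flip] at e₂ e₄
    simp only [hF]
    rw [bookMean_add, bookMean_add, bookMean_add]
    exact (add_le_add (add_le_add e₁ e₂) (add_le_add e₃ e₄)).trans (by linarith)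
  -- two packing errors cost `2 * ε` each, two covering errors `3 * ε` each
  have htot : ∑ a, pA a * bookMean (q a) (F a) ≤ 10 * ε := by
    refine (Finset.sum_le_sum fun a _ => mul_le_mul_of_nonneg_left (hmean a) (hA a)).trans ?_
    simp only [mul_add, Finset.sum_add_distrib, ← Finset.sum_mul, hA1, mul_left_comm _ (2 : ℝ),
      ← Finset.mul_sum]
    linarith
  obtain ⟨a, -, ha⟩ := exists_pos_le_of_sum_le hA hA1 htot
  have hm := sum_marg (h1 a)
  have hm' := sum_marg_flip (h1 a)
  have hmn := marg_nonneg (hq a)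
  have hmn' : ∀ c, 0 ≤ marg (flip (q a)) c := marg_nonneg fun _ _ => hq a _ _
  obtain ⟨c₁, -, hb₁⟩ := exists_pos_le_of_sum_le
    (fun c => Finset.prod_nonneg fun k _ => hmn (c k)) (sum_prod_eq_one hm) ha
  obtain ⟨c₂, hpos, hb₂⟩ := exists_pos_le_of_sum_le
    (fun c => Finset.prod_nonneg fun k _ => hmn' (c k)) (sum_prod_eq_one hm') hb₁
  refine ⟨a, c₁, c₂, φ₁ a c₁, φ₂ a c₂, fun l => (hmn' _).lt_of_ne fun h => ?_, hb₂⟩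
  exact hpos.ne' (Finset.prod_eq_zero (Finset.mem_univ l) h.symm)

end Mean

/-- The average `ℓ¹` distance between a random choice `s` of the codeword indices and the weights
`corr q`. -/
noncomputable def selDist (q : B → C → ℝ) (c₁ : M₁ × J₁ → B) (c₂ : M₂ × J₂ → C)
    (s : M₁ → M₂ → J₁ → J₂ → ℝ) : ℝ :=
  1 / ((Fintype.card M₁ : ℝ) * Fintype.card M₂) * ∑ w₁, ∑ w₂, ∑ j₁, ∑ j₂,
    |s w₁ w₂ j₁ j₂ - 1 / ((Fintype.card J₁ : ℝ) * Fintype.card J₂) *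
      corr q (c₁ (w₁, j₁)) (c₂ (w₂, j₂))|

theorem selDist_flip (q : B → C → ℝ) (c₁ : M₁ × J₁ → B) (c₂ : M₂ × J₂ → C)
    (s : M₁ → M₂ → J₁ → J₂ → ℝ) :
    selDist (flip q) c₂ c₁ (fun w₂ w₁ j₂ j₁ => s w₁ w₂ j₁ j₂) = selDist q c₁ c₂ s := by
  simp only [selDist, corr_flip]
  rw [Finset.sum_comm, mul_comm (Fintype.card M₂ : ℝ)]
  congr 1
  refine Finset.sum_congr rfl fun w₁ _ => Finset.sum_congr rfl fun w₂ _ => ?_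
  rw [Finset.sum_comm, mul_comm (Fintype.card J₂ : ℝ)]

/-- Nonnegative weights can be replaced by a probability distribution at an `ℓ¹` cost equal to the
defect of their total mass. -/
theorem exists_normalization {α : Type*} [Fintype α] [Nonempty α] {μ : α → ℝ}
    (hμ : ∀ a, 0 ≤ μ a) :
    ∃ s : α → ℝ, (∀ a, 0 ≤ s a) ∧ ∑ a, s a = 1 ∧ ∑ a, |s a - μ a| ≤ |1 - ∑ a, μ a| := by
  classical
  have hZ : 0 ≤ ∑ a, μ a := Finset.sum_nonneg fun a _ => hμ a
  rcases hZ.eq_or_lt with h | h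
  · have h0 : ∀ a, μ a = 0 := fun a =>
      (Finset.sum_eq_zero_iff_of_nonneg fun a _ => hμ a).1 h.symm a (Finset.mem_univ a)
    obtain ⟨a₀⟩ := ‹Nonempty α›
    refine ⟨fun a => if a = a₀ then 1 else 0, fun a => by dsimp only; split_ifs <;> norm_num, by simp, ?_⟩
    rw [← h]
    simp [h0, apply_ite abs]
  · refine ⟨fun a => μ a / ∑ a, μ a, fun a => div_nonneg (hμ a) hZ, ?_, ?_⟩
    · rw [← Finset.sum_div, div_self h.ne']
    · have : ∀ a, |μ a / ∑ a, μ a - μ a| = μ a * (|1 - ∑ a, μ a| / ∑ a, μ a) := by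
        intro a
        rw [show μ a / ∑ a, μ a - μ a = μ a * ((1 - ∑ a, μ a) / ∑ a, μ a) by field_simp, abs_mul,
          abs_of_nonneg (hμ a), abs_div, abs_of_pos h]
      simp only [this]
      rw [← Finset.sum_mul, mul_div_cancel₀ _ h.ne']

variable {q : B → C → ℝ} {K : B → C → D → ℝ} [Nonempty M₁] [Nonempty M₂] [Nonempty J₁] [Nonempty J₂]

/-- The weights `corr q` can be turned into a stochastic encoder, at a cost bounded by the covering
error. -/
theorem exists_selection (hq : ∀ b c, 0 ≤ q b c) (hK1 : ∀ b c, ∑ d, K b c d = 1)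
    (c₁ : M₁ × J₁ → B) {c₂ : M₂ × J₂ → C} (hc : ∀ l, 0 < marg (flip q) (c₂ l)) :
    ∃ s : M₁ → M₂ → J₁ → J₂ → ℝ, (∀ w₁ w₂ j₁ j₂, 0 ≤ s w₁ w₂ j₁ j₂) ∧
      (∀ w₁ w₂, ∑ j₁, ∑ j₂, s w₁ w₂ j₁ j₂ = 1) ∧ selDist q c₁ c₂ s ≤ covErr q K c₁ c₂ := by
  have h : ∀ w₁ w₂, ∃ s : J₁ × J₂ → ℝ, (∀ a, 0 ≤ s a) ∧ ∑ a, s a = 1 ∧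
      ∑ a, |s a - 1 / ((Fintype.card J₁ : ℝ) * Fintype.card J₂) *
        corr q (c₁ (w₁, a.1)) (c₂ (w₂, a.2))| ≤
      |1 - ∑ a : J₁ × J₂, 1 / ((Fintype.card J₁ : ℝ) * Fintype.card J₂) *
        corr q (c₁ (w₁, a.1)) (c₂ (w₂, a.2))| := fun w₁ w₂ =>
    exists_normalization fun a => mul_nonneg (by positivity) (corr_nonneg hq _ _)
  choose s hs0 hs1 hs using h
  refine ⟨fun w₁ w₂ j₁ j₂ => s w₁ w₂ (j₁, j₂), fun _ _ _ _ => hs0 _ _ _, fun w₁ w₂ => ?_, ?_⟩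
  · rw [← hs1 w₁ w₂, Fintype.sum_prod_type]
  · refine mul_le_mul_of_nonneg_left (Finset.sum_le_sum fun w₁ _ => Finset.sum_le_sum fun w₂ _ => ?_)
      (by positivity)
    have := hs w₁ w₂
    rw [Fintype.sum_prod_type] at this
    refine this.trans ?_
    have hJ₂ : (Fintype.card J₂ : ℝ) ≠ 0 := by exact_mod_cast Fintype.card_ne_zero
    have e : 1 - ∑ a : J₁ × J₂, 1 / ((Fintype.card J₁ : ℝ) * Fintype.card J₂) *
        corr q (c₁ (w₁, a.1)) (c₂ (w₂, a.2)) = -(1 / (Fintype.card J₂ : ℝ) * ∑ j₂, ∑ d,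
      (1 / (Fintype.card J₁ : ℝ) * ∑ j₁, corr q (c₁ (w₁, j₁)) (c₂ (w₂, j₂)) *
        K (c₁ (w₁, j₁)) (c₂ (w₂, j₂)) d - outCond q K (c₂ (w₂, j₂)) d)) := by
      simp only [Finset.sum_sub_distrib, sum_outCond hq hK1 (hc _), ← Finset.mul_sum]
      have : ∀ j₂, ∑ d, ∑ j₁, corr q (c₁ (w₁, j₁)) (c₂ (w₂, j₂)) *
          K (c₁ (w₁, j₁)) (c₂ (w₂, j₂)) d = ∑ j₁, corr q (c₁ (w₁, j₁)) (c₂ (w₂, j₂)) := by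
        intro j₂
        rw [Finset.sum_comm]
        simp [← Finset.mul_sum, hK1]
      simp only [this]
      rw [Fintype.sum_prod_type, Finset.sum_comm]
      simp only [Finset.sum_const, Finset.card_univ, nsmul_eq_mul, mul_one]
      field_simp
      ring
    rw [e, abs_neg, abs_mul, abs_of_nonneg (by positivity)]
    refine mul_le_mul_of_nonneg_left ?_ (by positivity)
    exact (Finset.abs_sum_le_sum_abs _ _).trans
      (Finset.sum_le_sum fun j₂ _ => Finset.abs_sum_le_sum_abs _ _)

theorem selection_error_le [DecidableEq M₁] (hK : ∀ b c d, 0 ≤ K b c d)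
    (hK1 : ∀ b c, ∑ d, K b c d = 1) (φ : D → M₁) (c₁ : M₁ × J₁ → B) (c₂ : M₂ × J₂ → C)
    (s : M₁ → M₂ → J₁ → J₂ → ℝ) :
    1 / ((Fintype.card M₁ : ℝ) * Fintype.card M₂) * ∑ w₁, ∑ w₂, ∑ j₁, ∑ j₂, s w₁ w₂ j₁ j₂ *
      ∑ d with φ d ≠ w₁, K (c₁ (w₁, j₁)) (c₂ (w₂, j₂)) d ≤
    packErr q K φ c₁ c₂ + selDist q c₁ c₂ s := by
  rw [packErr, selDist, ← mul_add]
  refine mul_le_mul_of_nonneg_left ?_ (by positivity)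
  simp only [Finset.mul_sum (Finset.univ (α := J₁)), Finset.mul_sum (Finset.univ (α := J₂)),
    ← Finset.sum_add_distrib]
  refine Finset.sum_le_sum fun w₁ _ => Finset.sum_le_sum fun w₂ _ => Finset.sum_le_sum fun j₁ _ =>
    Finset.sum_le_sum fun j₂ _ => ?_
  have h0 : 0 ≤ ∑ d with φ d ≠ w₁, K (c₁ (w₁, j₁)) (c₂ (w₂, j₂)) d :=
    Finset.sum_nonneg fun d _ => hK _ _ d
  have h1 : ∑ d with φ d ≠ w₁, K (c₁ (w₁, j₁)) (c₂ (w₂, j₂)) d ≤ 1 := by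
    rw [← hK1 (c₁ (w₁, j₁)) (c₂ (w₂, j₂))]
    exact Finset.sum_le_sum_of_subset_of_nonneg (Finset.filter_subset _ _) fun d _ _ => hK _ _ d
  set e := ∑ d with φ d ≠ w₁, K (c₁ (w₁, j₁)) (c₂ (w₂, j₂)) d
  set μ := 1 / ((Fintype.card J₁ : ℝ) * Fintype.card J₂) * corr q (c₁ (w₁, j₁)) (c₂ (w₂, j₂))
    with hμ
  rw [← mul_assoc, ← hμ]
  have := mul_le_mul_of_nonneg_left h1 (abs_nonneg (s w₁ w₂ j₁ j₂ - μ))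
  have := mul_le_mul_of_nonneg_right (le_abs_self (s w₁ w₂ j₁ j₂ - μ)) h0
  linarith

/-- The joint law of the message of the first user and the output at the other receiver is close to
a product with uniform first factor. -/
theorem exists_selection_secrecy (hK : ∀ b c d, 0 ≤ K b c d)
    (hK1 : ∀ b c, ∑ d, K b c d = 1) (c₁ : M₁ × J₁ → B) (c₂ : M₂ × J₂ → C)
    (s : M₁ → M₂ → J₁ → J₂ → ℝ) :
    ∃ ν : D → ℝ, ∑ w₁, ∑ d, |1 / ((Fintype.card M₁ : ℝ) * Fintype.card M₂) *
      (∑ w₂, ∑ j₁, ∑ j₂, s w₁ w₂ j₁ j₂ * K (c₁ (w₁, j₁)) (c₂ (w₂, j₂)) d) -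
        1 / Fintype.card M₁ * ν d| ≤ selDist q c₁ c₂ s + covErr q K c₁ c₂ := by
  have hM₁ : (Fintype.card M₁ : ℝ) ≠ 0 := by exact_mod_cast Fintype.card_ne_zero
  have hM₂ : (Fintype.card M₂ : ℝ) ≠ 0 := by exact_mod_cast Fintype.card_ne_zero
  have hJ₁ : (Fintype.card J₁ : ℝ) ≠ 0 := by exact_mod_cast Fintype.card_ne_zero
  have hJ₂ : (Fintype.card J₂ : ℝ) ≠ 0 := by exact_mod_cast Fintype.card_ne_zero
  refine ⟨fun d => 1 / (Fintype.card M₂ : ℝ) * ∑ w₂, 1 / (Fintype.card J₂ : ℝ) *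
    ∑ j₂, outCond q K (c₂ (w₂, j₂)) d, ?_⟩
  rw [selDist, covErr, ← mul_add, ← Finset.sum_add_distrib, Finset.mul_sum]
  refine Finset.sum_le_sum fun w₁ _ => ?_
  have hpt : ∀ d, |1 / ((Fintype.card M₁ : ℝ) * Fintype.card M₂) *
      (∑ w₂, ∑ j₁, ∑ j₂, s w₁ w₂ j₁ j₂ * K (c₁ (w₁, j₁)) (c₂ (w₂, j₂)) d) -
        1 / Fintype.card M₁ * (1 / (Fintype.card M₂ : ℝ) * ∑ w₂, 1 / (Fintype.card J₂ : ℝ) *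
    ∑ j₂, outCond q K (c₂ (w₂, j₂)) d)| ≤ 1 / ((Fintype.card M₁ : ℝ) * Fintype.card M₂) *
      ∑ w₂, ((∑ j₁, ∑ j₂, |s w₁ w₂ j₁ j₂ - 1 / ((Fintype.card J₁ : ℝ) * Fintype.card J₂) *
      corr q (c₁ (w₁, j₁)) (c₂ (w₂, j₂))| * K (c₁ (w₁, j₁)) (c₂ (w₂, j₂)) d) +
      1 / (Fintype.card J₂ : ℝ) * ∑ j₂,
      |1 / (Fintype.card J₁ : ℝ) * ∑ j₁, corr q (c₁ (w₁, j₁)) (c₂ (w₂, j₂)) *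
        K (c₁ (w₁, j₁)) (c₂ (w₂, j₂)) d - outCond q K (c₂ (w₂, j₂)) d|) := by
    intro d
    rw [← mul_assoc, one_div_mul_one_div, ← mul_sub, ← Finset.sum_sub_distrib, abs_mul,
      abs_of_nonneg (by positivity)]
    refine mul_le_mul_of_nonneg_left ((Finset.abs_sum_le_sum_abs _ _).trans
      (Finset.sum_le_sum fun w₂ _ => ?_)) (by positivity)
    have e : ∑ j₁, ∑ j₂, s w₁ w₂ j₁ j₂ * K (c₁ (w₁, j₁)) (c₂ (w₂, j₂)) d -
        1 / (Fintype.card J₂ : ℝ) * ∑ j₂, outCond q K (c₂ (w₂, j₂)) d =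
        (∑ j₁, ∑ j₂, (s w₁ w₂ j₁ j₂ - 1 / ((Fintype.card J₁ : ℝ) * Fintype.card J₂) *
          corr q (c₁ (w₁, j₁)) (c₂ (w₂, j₂))) * K (c₁ (w₁, j₁)) (c₂ (w₂, j₂)) d) +
        1 / (Fintype.card J₂ : ℝ) * ∑ j₂, (1 / (Fintype.card J₁ : ℝ) *
          ∑ j₁, corr q (c₁ (w₁, j₁)) (c₂ (w₂, j₂)) *
            K (c₁ (w₁, j₁)) (c₂ (w₂, j₂)) d - outCond q K (c₂ (w₂, j₂)) d) := by
      simp only [sub_mul, Finset.sum_sub_distrib, mul_assoc, ← Finset.mul_sum]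
      rw [Finset.sum_comm (s := Finset.univ (α := J₁)) (t := Finset.univ (α := J₂))
        (f := fun j₁ j₂ => corr q (c₁ (w₁, j₁)) (c₂ (w₂, j₂)) * K (c₁ (w₁, j₁)) (c₂ (w₂, j₂)) d)]
      field_simp
      ring
    rw [e]
    refine (abs_add_le _ _).trans (add_le_add ?_ ?_)
    · refine (Finset.abs_sum_le_sum_abs _ _).trans (Finset.sum_le_sum fun j₁ _ =>
        (Finset.abs_sum_le_sum_abs _ _).trans (Finset.sum_le_sum fun j₂ _ => ?_))
      rw [abs_mul, abs_of_nonneg (hK _ _ _)]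
    · rw [abs_mul, abs_of_nonneg (by positivity)]
      exact mul_le_mul_of_nonneg_left (Finset.abs_sum_le_sum_abs _ _) (by positivity)
  refine (Finset.sum_le_sum fun d _ => hpt d).trans (le_of_eq ?_)
  rw [← Finset.mul_sum, Finset.sum_comm]
  simp only [Finset.sum_add_distrib]
  congr 2
  · refine Finset.sum_congr rfl fun w₂ _ => ?_
    rw [Finset.sum_comm]
    refine Finset.sum_congr rfl fun j₁ _ => ?_
    rw [Finset.sum_comm]
    simp [← Finset.mul_sum, hK1]
  · refine Finset.sum_congr rfl fun w₂ _ => ?_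
    rw [← Finset.mul_sum, Finset.sum_comm]

end Codebook

/-! ### Laws and equivocation -/

section Law

variable {Ω α β γ : Type*} [Fintype Ω]

theorem law_nonneg {p : Ω → ℝ} (hp : ∀ ω, 0 ≤ p ω) (f : Ω → α) (a : α) : 0 ≤ law p f a :=
  Finset.sum_nonneg fun ω _ => hp ω

theorem sum_law_mul [Fintype α] (p : Ω → ℝ) (f : Ω → α) (F : α → ℝ) :
    ∑ a, law p f a * F a = ∑ ω, p ω * F (f ω) := by
  classical
  simp only [law, Finset.sum_filter, Finset.sum_mul]
  rw [Finset.sum_comm]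
  refine Finset.sum_congr rfl fun ω _ => ?_
  rw [Finset.sum_eq_single (f ω)]
  · simp
  · intro a _ ha; simp [ha.symm]
  · simp

theorem sum_law [Fintype α] (p : Ω → ℝ) (f : Ω → α) : ∑ a, law p f a = ∑ ω, p ω := by
  simpa using sum_law_mul p f fun _ => 1

open Classical in
theorem law_comp [Fintype α] (p : Ω → ℝ) (f : Ω → α) (φ : α → β) :
    law p (fun ω => φ (f ω)) = law (law p f) φ := by
  funext b
  have h := sum_law_mul p f fun a => if φ a = b then 1 else 0
  simp only [mul_ite, mul_one, mul_zero] at h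
  rw [law, law, Finset.sum_filter, Finset.sum_filter, ← h]

theorem law_snd [Fintype α] [Fintype β] (p : Ω → ℝ) (f : Ω → α) (g : Ω → β) (b : β) :
    law p g b = ∑ a, law p (fun ω => (f ω, g ω)) (a, b) := by
  classical
  have h := congrFun (law_comp p (fun ω => (f ω, g ω)) Prod.snd) b
  rw [h, law, Finset.sum_filter, Fintype.sum_prod_type]
  simp

theorem condEntropy_comp [Fintype α] [Fintype β] [Fintype γ] (p : Ω → ℝ) (k : Ω → γ)
    (f : γ → α) (g : γ → β) :
    condEntropy p (fun ω => f (k ω)) (fun ω => g (k ω)) = condEntropy (law p k) f g := by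
  simp only [condEntropy, ← law_comp]

/-- The contribution of one pair of values to the divergence from a law with uniform first factor:
`x` is the joint probability, `y` the marginal one, and `M` the number of values of the uniform
variable. -/
theorem mul_logb_le {x y M : ℝ} (hM : 1 ≤ M) (hx : 0 ≤ x) (hxy : x ≤ y) :
    x * (Real.logb 2 M + Real.logb 2 (x / y)) ≤ (Real.logb 2 M + 2) * |x - y / M| := by
  have hlM : 0 ≤ Real.logb 2 M := Real.logb_nonneg (by norm_num) hM
  rcases hx.eq_or_lt with h | h
  · rw [← h, zero_mul]; positivity
  have hy : 0 < y := h.trans_le hxy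
  have hM0 : 0 < M := by linarith
  set t := M * (x / y) with ht
  have ht0 : 0 < t := by positivity
  rw [← Real.logb_mul hM0.ne' (by positivity), ← ht]
  rcases le_total t 1 with h1 | h1
  · refine le_trans (mul_nonpos_of_nonneg_of_nonpos hx ?_) (by positivity)
    exact Real.logb_nonpos (by norm_num) ht0.le h1
  · have htM : t ≤ M := by
      rw [ht]; exact mul_le_of_le_one_right hM0.le ((div_le_one hy).2 hxy)
    have hl1 : Real.logb 2 t ≤ Real.logb 2 M := Real.logb_le_logb_of_le (by norm_num) ht0 htM
    -- the constant `2` bounds `1 / log 2`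
    have hl2 : Real.logb 2 t ≤ 2 * (t - 1) := by
      rw [Real.logb, div_le_iff₀ (Real.log_pos (by norm_num))]
      have := Real.log_le_sub_one_of_pos ht0
      have := Real.log_two_gt_d9
      nlinarith
    have e : x = y / M * t := by rw [ht]; field_simp
    have e2 : x - y / M = y / M * (t - 1) := by rw [e]; ring
    rw [e2, abs_of_nonneg (mul_nonneg (by positivity) (by linarith)), e]
    have : t * Real.logb 2 t ≤ (Real.logb 2 M + 2) * (t - 1) := by
      nlinarith [mul_le_mul_of_nonneg_left hl1 (sub_nonneg.2 h1)]
    calc y / M * t * Real.logb 2 t = y / M * (t * Real.logb 2 t) := by ring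
      _ ≤ y / M * ((Real.logb 2 M + 2) * (t - 1)) := by gcongr
      _ = _ := by ring

/-- If the joint law of `f` and `g` is close in `ℓ¹` to a product with uniform first factor, then
the equivocation of `f` given `g` is close to its largest possible value. -/
theorem logb_card_sub_condEntropy_le [Fintype α] [Nonempty α] [Fintype β] {p : Ω → ℝ}
    (hp : ∀ ω, 0 ≤ p ω) (hp1 : ∑ ω, p ω = 1) (f : Ω → α) (g : Ω → β) (ν : β → ℝ) :
    Real.logb 2 (Fintype.card α) - condEntropy p f g ≤ 2 * (Real.logb 2 (Fintype.card α) + 2) *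
      ∑ a, ∑ b, |law p (fun ω => (f ω, g ω)) (a, b) - 1 / Fintype.card α * ν b| := by
  set M : ℝ := (Fintype.card α : ℝ) with hM
  have hM1 : 1 ≤ M := by rw [hM]; exact_mod_cast Fintype.card_pos
  set ρ : α → β → ℝ := fun a b => law p (fun ω => (f ω, g ω)) (a, b) with hρ
  have hρ0 : ∀ a b, 0 ≤ ρ a b := fun a b => law_nonneg hp _ _
  have hg : ∀ b, law p g b = ∑ a, ρ a b := fun b => law_snd p f g b
  have hρ1 : ∑ a, ∑ b, ρ a b = 1 := by
    rw [← hp1, ← sum_law p (fun ω => (f ω, g ω)), Fintype.sum_prod_type]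
  have hlM : 0 ≤ Real.logb 2 M := Real.logb_nonneg (by norm_num) hM1
  have h1 : Real.logb 2 M - condEntropy p f g =
      ∑ a, ∑ b, ρ a b * (Real.logb 2 M + Real.logb 2 (ρ a b / law p g b)) := by
    simp only [mul_add, Finset.sum_add_distrib, ← Finset.sum_mul, hρ1, one_mul, condEntropy,
      sub_neg_eq_add]
    rfl
  have h2 : ∑ a, ∑ b, |ρ a b - law p g b / M| ≤ 2 * ∑ a, ∑ b, |ρ a b - 1 / M * ν b| := by
    have h3 : ∀ b, |ν b - law p g b| ≤ ∑ a, |ρ a b - 1 / M * ν b| := by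
      intro b
      have : law p g b - ν b = ∑ a, (ρ a b - 1 / M * ν b) := by
        rw [Finset.sum_sub_distrib, ← hg]
        simp only [Finset.sum_const, Finset.card_univ, nsmul_eq_mul, ← hM]
        field_simp
      rw [abs_sub_comm, this]
      exact Finset.abs_sum_le_sum_abs _ _
    have h4 : ∀ a b, |ρ a b - law p g b / M| ≤
        |ρ a b - 1 / M * ν b| + 1 / M * ∑ a, |ρ a b - 1 / M * ν b| := by
      intro a b
      rw [show ρ a b - law p g b / M = (ρ a b - 1 / M * ν b) + 1 / M * (ν b - law p g b) by ring]
      refine (abs_add_le _ _).trans (add_le_add le_rfl ?_)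
      rw [abs_mul, abs_of_nonneg (by positivity)]
      exact mul_le_mul_of_nonneg_left (h3 b) (by positivity)
    refine (Finset.sum_le_sum fun a _ => Finset.sum_le_sum fun b _ => h4 a b).trans (le_of_eq ?_)
    simp only [Finset.sum_add_distrib, ← Finset.mul_sum, Finset.sum_const, Finset.card_univ,
      nsmul_eq_mul, ← hM]
    rw [Finset.sum_comm (s := Finset.univ (α := β)), ← mul_assoc,
      one_div_mul_cancel (by positivity), one_mul, two_mul]
  rw [h1]
  calc _ ≤ ∑ a, ∑ b, (Real.logb 2 M + 2) * |ρ a b - law p g b / M| := by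
        refine Finset.sum_le_sum fun a _ => Finset.sum_le_sum fun b _ =>
          mul_logb_le hM1 (hρ0 a b) ?_
        rw [hg]
        exact Finset.single_le_sum (f := fun a => ρ a b) (fun a _ => hρ0 a b) (Finset.mem_univ a)
    _ = (Real.logb 2 M + 2) * ∑ a, ∑ b, |ρ a b - law p g b / M| := by
        simp only [← Finset.mul_sum]
    _ ≤ (Real.logb 2 M + 2) * (2 * ∑ a, ∑ b, |ρ a b - 1 / M * ν b|) := by gcongr
    _ = _ := by ring

end Law

/-! ### Block extensions and the law of large numbers -/

section Block

variable {U B C D : Type*} [Fintype U] [Fintype B] [Fintype C] [Fintype D]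

open Classical in
/-- Weak law of large numbers: an event that forces, on the support of `p`, a deviation `n * δ` of
an i.i.d. sum from its mean has vanishing probability. -/
theorem eventually_iidMean_le {p : B → ℝ} (hp0 : ∀ b, 0 ≤ p b) (hp : ∑ b, p b = 1) (f : B → ℝ)
    {δ ε : ℝ} (hδ : 0 < δ) (hε : 0 < ε) :
    ∀ᶠ n : ℕ in Filter.atTop, ∀ E : (Fin n → B) → Prop,
      (∀ c, (∀ i, 0 < p (c i)) → E c → n * δ ≤ |∑ i, f (c i) - n * ∑ b, p b * f b|) →
      iidMean p (fun c => if E c then 1 else 0) ≤ ε := by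
  have ht : Filter.Tendsto (fun n : ℕ => (n : ℝ) * (δ ^ 2 * ε)) Filter.atTop Filter.atTop :=
    tendsto_natCast_atTop_atTop.atTop_mul_const (by positivity)
  filter_upwards [ht.eventually_ge_atTop (∑ b, p b * f b ^ 2), Filter.eventually_gt_atTop 0]
    with n hn hn0 E hE
  have hn0' : (0 : ℝ) < n := by exact_mod_cast hn0
  have h := iidMean_chebyshev (ι := Fin n) hp0 hp f hδ (E := fun c => (∀ i, 0 < p (c i)) ∧ E c)
    (fun c hc => by simpa using hE c hc.1 hc.2)
  rw [Fintype.card_fin] at h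
  have e : iidMean p (fun c => if (∀ i, 0 < p (c i)) ∧ E c then (1 : ℝ) else 0) =
      iidMean p (fun c => if E c then 1 else 0) := by
    refine Finset.sum_congr rfl fun c _ => ?_
    by_cases hc : ∀ i, 0 < p (c i)
    · simp only [hc, implies_true, true_and]
    · push Not at hc
      obtain ⟨i, hi⟩ := hc
      rw [Finset.prod_eq_zero (Finset.mem_univ i) (le_antisymm hi (hp0 _)), zero_mul, zero_mul]
  rw [e] at h
  have hpos : 0 < (n : ℝ) * δ ^ 2 := by positivity
  refine le_of_mul_le_mul_right (h.trans (hn.trans (le_of_eq ?_))) hpos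
  ring

variable {ι : Type*} [Fintype ι] [DecidableEq ι]

/-- The law of a block of letter pairs, independent with laws `q (a i)`. -/
noncomputable def blockPair (q : U → B → C → ℝ) (a : ι → U) (b : ι → B) (c : ι → C) : ℝ :=
  ∏ i, q (a i) (b i) (c i)

/-- The memoryless extension of the channel `K` with two inputs. -/
noncomputable def blockKernel (K : B → C → D → ℝ) (b : ι → B) (c : ι → C) (d : ι → D) : ℝ :=
  ∏ i, K (b i) (c i) (d i)

theorem blockPair_nonneg {q : U → B → C → ℝ} (hq : ∀ u b c, 0 ≤ q u b c) (a : ι → U) (b : ι → B)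
    (c : ι → C) : 0 ≤ blockPair q a b c :=
  Finset.prod_nonneg fun _ _ => hq _ _ _

theorem blockKernel_nonneg {K : B → C → D → ℝ} (hK : ∀ b c d, 0 ≤ K b c d) (b : ι → B) (c : ι → C)
    (d : ι → D) : 0 ≤ blockKernel K b c d :=
  Finset.prod_nonneg fun _ _ => hK _ _ _

theorem marg_blockPair (q : U → B → C → ℝ) (a : ι → U) (b : ι → B) :
    marg (blockPair q a) b = ∏ i, marg (q (a i)) (b i) :=
  sum_prod_apply fun i c => q (a i) (b i) c

theorem marg_flip_blockPair (q : U → B → C → ℝ) (a : ι → U) (c : ι → C) :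
    marg (flip (blockPair q a)) c = ∏ i, marg (flip (q (a i))) (c i) :=
  sum_prod_apply fun i b => q (a i) b (c i)

theorem sum_blockPair {q : U → B → C → ℝ} (h1 : ∀ u, ∑ b, ∑ c, q u b c = 1) (a : ι → U) :
    ∑ b, ∑ c, blockPair q a b c = 1 := by
  change ∑ b, marg (blockPair q a) b = 1
  simp only [marg_blockPair]
  rw [sum_prod_apply fun i b => marg (q (a i)) b]
  exact Finset.prod_eq_one fun i _ => h1 _

theorem sum_blockKernel {K : B → C → D → ℝ} (hK1 : ∀ b c, ∑ d, K b c d = 1) (b : ι → B)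
    (c : ι → C) : ∑ d, blockKernel K b c d = 1 := by
  simp only [blockKernel]
  rw [sum_prod_apply fun i d => K (b i) (c i) d]
  exact Finset.prod_eq_one fun i _ => hK1 _ _

theorem outJoint_block (q : U → B → C → ℝ) (K : B → C → D → ℝ) (a : ι → U) (b : ι → B)
    (d : ι → D) : outJoint (blockPair q a) (blockKernel K) b d =
      ∏ i, outJoint (q (a i)) K (b i) (d i) := by
  simp only [outJoint, blockPair, blockKernel, ← Finset.prod_mul_distrib]
  exact sum_prod_apply fun i c => q (a i) (b i) c * K (b i) c (d i)

theorem outMarg_block (q : U → B → C → ℝ) (K : B → C → D → ℝ) (a : ι → U) (d : ι → D) :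
    outMarg (blockPair q a) (blockKernel K) d = ∏ i, outMarg (q (a i)) K (d i) := by
  simp only [outMarg, outJoint_block]
  exact sum_prod_apply fun i b => outJoint (q (a i)) K b (d i)

theorem corr_block (q : U → B → C → ℝ) (a : ι → U) (b : ι → B) (c : ι → C) :
    corr (blockPair q a) b c = ∏ i, corr (q (a i)) (b i) (c i) := by
  simp only [corr, marg_blockPair, marg_flip_blockPair, Finset.prod_div_distrib,
    Finset.prod_mul_distrib]
  rfl

theorem outCond_block (q : U → B → C → ℝ) (K : B → C → D → ℝ) (a : ι → U) (c : ι → C)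
    (d : ι → D) : outCond (blockPair q a) (blockKernel K) c d =
      ∏ i, outCond (q (a i)) K (c i) (d i) := by
  simp only [outCond, corr_block, marg_blockPair, blockKernel, ← Finset.prod_mul_distrib]
  exact sum_prod_apply fun i b => marg (q (a i)) b * (corr (q (a i)) b (c i) * K b (c i) (d i))

/-- The joint law of the auxiliary letters and one output. -/
def jointLaw (pU : U → ℝ) (q : U → B → C → ℝ) (K : B → C → D → ℝ) (ω : U × B × C × D) : ℝ :=
  pU ω.1 * q ω.1 ω.2.1 ω.2.2.1 * K ω.2.1 ω.2.2.1 ω.2.2.2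

/-- The density of the law of the first letter and the output with respect to the product of their
marginals. -/
noncomputable def packDens (q : B → C → ℝ) (K : B → C → D → ℝ) (b : B) (d : D) : ℝ :=
  outJoint q K b d / (marg q b * outMarg q K d)

/-- The density of the law of the first letter, given the second letter and the output, with
respect to its marginal law. -/
noncomputable def covDens (q : B → C → ℝ) (K : B → C → D → ℝ) (b : B) (c : C) (d : D) : ℝ :=
  corr q b c * K b c d / outCond q K c d

/-- The mean of the logarithm of `packDens`. -/
noncomputable def packInfo (pU : U → ℝ) (q : U → B → C → ℝ) (K : B → C → D → ℝ) : ℝ :=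
  ∑ ω, jointLaw pU q K ω * Real.logb 2 (packDens (q ω.1) K ω.2.1 ω.2.2.2)

/-- The mean of the logarithm of `covDens`. -/
noncomputable def covInfo (pU : U → ℝ) (q : U → B → C → ℝ) (K : B → C → D → ℝ) : ℝ :=
  ∑ ω, jointLaw pU q K ω * Real.logb 2 (covDens (q ω.1) K ω.2.1 ω.2.2.1 ω.2.2.2)

theorem sum_pi_prod {β γ : Type*} [Fintype β] [Fintype γ] (F : (ι → β × γ) → ℝ) :
    ∑ ω, F ω = ∑ x : ι → β, ∑ y : ι → γ, F fun i => (x i, y i) := by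
  rw [← Fintype.sum_prod_type' (f := fun (x : ι → β) (y : ι → γ) => F fun i => (x i, y i))]
  exact Fintype.sum_equiv (Equiv.arrowProdEquivProdArrow ι (fun _ => β) (fun _ => γ)) _ _
    fun ω => rfl

theorem iidMean_jointLaw (pU : U → ℝ) (q : U → B → C → ℝ) (K : B → C → D → ℝ)
    (F : (ι → U × B × C × D) → ℝ) :
    iidMean (jointLaw pU q K) F = ∑ a : ι → U, (∏ i, pU (a i)) * ∑ b, ∑ c, ∑ d,
      blockPair q a b c * blockKernel K b c d * F fun i => (a i, b i, c i, d i) := by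
  rw [iidMean, sum_pi_prod]
  refine Finset.sum_congr rfl fun a _ => ?_
  rw [sum_pi_prod, Finset.mul_sum]
  refine Finset.sum_congr rfl fun b _ => ?_
  rw [sum_pi_prod, Finset.mul_sum]
  refine Finset.sum_congr rfl fun c _ => ?_
  rw [Finset.mul_sum]
  refine Finset.sum_congr rfl fun d _ => ?_
  simp only [jointLaw, Finset.prod_mul_distrib, blockPair, blockKernel]
  ring

theorem jointLaw_nonneg {pU : U → ℝ} (hU : ∀ u, 0 ≤ pU u) {q : U → B → C → ℝ}
    (hq : ∀ u b c, 0 ≤ q u b c) {K : B → C → D → ℝ} (hK : ∀ b c d, 0 ≤ K b c d)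
    (ω : U × B × C × D) : 0 ≤ jointLaw pU q K ω :=
  mul_nonneg (mul_nonneg (hU _) (hq _ _ _)) (hK _ _ _)

theorem sum_jointLaw {pU : U → ℝ} (hU1 : ∑ u, pU u = 1) {q : U → B → C → ℝ}
    (h1 : ∀ u, ∑ b, ∑ c, q u b c = 1) {K : B → C → D → ℝ} (hK1 : ∀ b c, ∑ d, K b c d = 1) :
    ∑ ω, jointLaw pU q K ω = 1 := by
  simp only [Fintype.sum_prod_type, jointLaw, ← Finset.mul_sum, hK1, mul_one, h1, hU1]

/-- All the laws entering the two densities are positive on the support of `jointLaw`. -/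
theorem pos_of_jointLaw_pos {pU : U → ℝ} (hU : ∀ u, 0 ≤ pU u) {q : U → B → C → ℝ}
    (hq : ∀ u b c, 0 ≤ q u b c) {K : B → C → D → ℝ} (hK : ∀ b c d, 0 ≤ K b c d)
    {u : U} {b : B} {c : C} {d : D} (h : 0 < jointLaw pU q K (u, b, c, d)) :
    0 < pU u ∧ 0 < outJoint (q u) K b d ∧ 0 < marg (q u) b ∧ 0 < outMarg (q u) K d ∧
      0 < marg (flip (q u)) c ∧ 0 < corr (q u) b c * K b c d ∧ 0 < outCond (q u) K c d := by
  simp only [jointLaw] at h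
  have hK' : 0 < K b c d := (hK b c d).lt_of_ne fun e => by rw [← e, mul_zero] at h; exact h.false
  have hq' : 0 < q u b c := (hq u b c).lt_of_ne fun e => by simp [← e] at h
  have hU' : 0 < pU u := (hU u).lt_of_ne fun e => by simp [← e] at h
  have hm : 0 < marg (q u) b := hq'.trans_le (le_marg (hq u) b c)
  have hm' : 0 < marg (flip (q u)) c :=
    hq'.trans_le (le_marg (q := flip (q u)) (fun _ _ => hq u _ _) c b)
  have hJ : 0 < outJoint (q u) K b d := (mul_pos hq' hK').trans_le
    (Finset.single_le_sum (f := fun c => q u b c * K b c d)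
      (fun c _ => mul_nonneg (hq u b c) (hK b c d)) (Finset.mem_univ c))
  have hc : 0 < corr (q u) b c * K b c d := mul_pos (div_pos hq' (mul_pos hm hm')) hK'
  refine ⟨hU', hJ, hm, ?_, hm', hc, ?_⟩
  · exact hJ.trans_le (Finset.single_le_sum (f := fun b => outJoint (q u) K b d)
      (fun b _ => outJoint_nonneg (hq u) hK b d) (Finset.mem_univ b))
  · exact (mul_pos hm hc).trans_le (Finset.single_le_sum
      (f := fun b => marg (q u) b * (corr (q u) b c * K b c d))
      (fun b _ => mul_nonneg (marg_nonneg (hq u) b) (mul_nonneg (corr_nonneg (hq u) b c)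
        (hK b c d))) (Finset.mem_univ b))

theorem eventually_packTail_le {pU : U → ℝ} (hU : ∀ u, 0 ≤ pU u) (hU1 : ∑ u, pU u = 1)
    {q : U → B → C → ℝ} (hq : ∀ u b c, 0 ≤ q u b c) (h1 : ∀ u, ∑ b, ∑ c, q u b c = 1)
    {K : B → C → D → ℝ} (hK : ∀ b c d, 0 ≤ K b c d) (hK1 : ∀ b c, ∑ d, K b c d = 1)
    {δ ε : ℝ} (hδ : 0 < δ) (hε : 0 < ε) :
    ∀ᶠ n : ℕ in Filter.atTop,
    ∑ a : Fin n → U, (∏ i, pU (a i)) * packTail (blockPair q a) (blockKernel K)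
      ((2 : ℝ) ^ (n * (packInfo pU q K - δ))) ≤ ε := by
  classical
  filter_upwards [eventually_iidMean_le (jointLaw_nonneg hU hq hK) (sum_jointLaw hU1 h1 hK1)
    (fun ω => Real.logb 2 (packDens (q ω.1) K ω.2.1 ω.2.2.2)) hδ hε] with n hn
  have := hn (fun ω => outJoint (blockPair q fun i => (ω i).1) (blockKernel K)
      (fun i => (ω i).2.1) (fun i => (ω i).2.2.2) ≤ (2 : ℝ) ^ (n * (packInfo pU q K - δ)) *
      (marg (blockPair q fun i => (ω i).1) (fun i => (ω i).2.1) *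
        outMarg (blockPair q fun i => (ω i).1) (blockKernel K) (fun i => (ω i).2.2.2))) ?_
  · rw [iidMean_jointLaw] at this
    refine le_trans (le_of_eq ?_) this
    simp only [packTail]
  · intro ω hpos hE
    have hp := fun i => pos_of_jointLaw_pos hU hq hK (hpos i)
    rw [outJoint_block, marg_blockPair, outMarg_block, ← Finset.prod_mul_distrib,
      ← div_le_iff₀ (Finset.prod_pos fun i _ => mul_pos (hp i).2.2.1 (hp i).2.2.2.1),
      ← Finset.prod_div_distrib] at hE
    have hd : ∀ i, 0 < packDens (q (ω i).1) K (ω i).2.1 (ω i).2.2.2 := fun i =>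
      div_pos (hp i).2.1 (mul_pos (hp i).2.2.1 (hp i).2.2.2.1)
    have := Real.logb_le_logb_of_le (b := 2) (by norm_num) (Finset.prod_pos fun i _ => hd i) hE
    rw [Real.logb_rpow (by norm_num) (by norm_num),
      Real.logb_prod _ _ fun i _ => (hd i).ne'] at this
    rw [abs_sub_comm]
    refine le_trans ?_ (le_abs_self _)
    simp only [packInfo] at this ⊢
    linarith

theorem eventually_covTail_le {pU : U → ℝ} (hU : ∀ u, 0 ≤ pU u) (hU1 : ∑ u, pU u = 1)
    {q : U → B → C → ℝ} (hq : ∀ u b c, 0 ≤ q u b c) (h1 : ∀ u, ∑ b, ∑ c, q u b c = 1)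
    {K : B → C → D → ℝ} (hK : ∀ b c d, 0 ≤ K b c d) (hK1 : ∀ b c, ∑ d, K b c d = 1)
    {δ ε : ℝ} (hδ : 0 < δ) (hε : 0 < ε) :
    ∀ᶠ n : ℕ in Filter.atTop,
    ∑ a : Fin n → U, (∏ i, pU (a i)) * covTail (blockPair q a) (blockKernel K)
      ((2 : ℝ) ^ (n * (covInfo pU q K + δ))) ≤ ε := by
  classical
  filter_upwards [eventually_iidMean_le (jointLaw_nonneg hU hq hK) (sum_jointLaw hU1 h1 hK1)
    (fun ω => Real.logb 2 (covDens (q ω.1) K ω.2.1 ω.2.2.1 ω.2.2.2)) hδ hε] with n hn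
  have := hn (fun ω => (2 : ℝ) ^ (n * (covInfo pU q K + δ)) *
      outCond (blockPair q fun i => (ω i).1) (blockKernel K) (fun i => (ω i).2.2.1)
        (fun i => (ω i).2.2.2) <
      corr (blockPair q fun i => (ω i).1) (fun i => (ω i).2.1) (fun i => (ω i).2.2.1) *
        blockKernel K (fun i => (ω i).2.1) (fun i => (ω i).2.2.1) (fun i => (ω i).2.2.2)) ?_
  · rw [iidMean_jointLaw] at this
    refine le_trans (le_of_eq ?_) this
    simp only [covTail]
  · intro ω hpos hE
    have hp := fun i => pos_of_jointLaw_pos hU hq hK (hpos i)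
    rw [outCond_block, corr_block, blockKernel, ← Finset.prod_mul_distrib,
      ← lt_div_iff₀ (Finset.prod_pos fun i _ => (hp i).2.2.2.2.2.2),
      ← Finset.prod_div_distrib] at hE
    have hd : ∀ i, 0 < covDens (q (ω i).1) K (ω i).2.1 (ω i).2.2.1 (ω i).2.2.2 := fun i =>
      div_pos (hp i).2.2.2.2.2.1 (hp i).2.2.2.2.2.2
    have := Real.logb_le_logb_of_le (b := 2) (by norm_num) (by positivity) hE.le
    rw [Real.logb_rpow (by norm_num) (by norm_num)] at this
    have h2 := Real.logb_prod (b := 2) Finset.univ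
      (fun i => covDens (q (ω i).1) K (ω i).2.1 (ω i).2.2.1 (ω i).2.2.2) fun i _ => (hd i).ne'
    simp only [covDens] at h2
    rw [h2] at this
    refine le_trans ?_ (le_abs_self _)
    simp only [covInfo, covDens] at this ⊢
    linarith

end Block

/-! ### Single-letter information quantities -/

section Info

variable {Ω α β γ : Type*} [Fintype Ω] [Fintype α] [Fintype β] [Fintype γ]

theorem condEntropy_eq_sum (p : Ω → ℝ) (f : Ω → α) (g : Ω → β) :
    condEntropy p f g = -∑ ω, p ω *
      Real.logb 2 (law p (fun ω => (f ω, g ω)) (f ω, g ω) / law p g (g ω)) := by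
  rw [condEntropy, ← sum_law_mul p (fun ω => (f ω, g ω)) fun ab =>
    Real.logb 2 (law p (fun ω => (f ω, g ω)) ab / law p g ab.2), Fintype.sum_prod_type]

theorem le_law {p : Ω → ℝ} (hp : ∀ ω, 0 ≤ p ω) (f : Ω → α) (ω : Ω) : p ω ≤ law p f (f ω) := by
  classical
  exact Finset.single_le_sum (fun ω _ => hp ω) (Finset.mem_filter.2 ⟨Finset.mem_univ ω, rfl⟩)

theorem law_apply_ne_zero {p : Ω → ℝ} (hp : ∀ ω, 0 ≤ p ω) {ω : Ω} (h : 0 < p ω) (f : Ω → α) :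
    law p f (f ω) ≠ 0 :=
  (h.trans_le (le_law hp f ω)).ne'

/-- Symmetry is needed because the bound for the second user subtracts `I(V₁; V₂ | U)`, while the
covering constraint of that user telescopes with `I(V₂; V₁ | U)`. -/
theorem condMutualInfo_comm {p : Ω → ℝ} (hp : ∀ ω, 0 ≤ p ω) (f : Ω → α) (g : Ω → β) (h : Ω → γ) :
    condMutualInfo p f g h = condMutualInfo p g f h := by
  simp only [condMutualInfo, condEntropy_eq_sum, ← Finset.sum_neg_distrib,
    ← Finset.sum_sub_distrib]
  refine Finset.sum_congr rfl fun ω _ => ?_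
  rcases (hp ω).eq_or_lt with h0 | h0
  · simp [← h0]
  have e : law p (fun ω => (f ω, g ω, h ω)) (f ω, g ω, h ω) =
      law p (fun ω => (g ω, f ω, h ω)) (g ω, f ω, h ω) := by
    simp only [law, Prod.mk.injEq]
    congr 1
    ext ω'
    simp only [Finset.mem_filter, Finset.mem_univ, true_and, Prod.mk.injEq]
    tauto
  rw [Real.logb_div (law_apply_ne_zero hp h0 fun ω => (f ω, h ω)) (law_apply_ne_zero hp h0 h),
    Real.logb_div (law_apply_ne_zero hp h0 fun ω => (f ω, g ω, h ω)) (law_apply_ne_zero hp h0 fun ω => (g ω, h ω)),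
    Real.logb_div (law_apply_ne_zero hp h0 fun ω => (g ω, h ω)) (law_apply_ne_zero hp h0 h),
    Real.logb_div (law_apply_ne_zero hp h0 fun ω => (g ω, f ω, h ω)) (law_apply_ne_zero hp h0 fun ω => (f ω, h ω)), e]
  ring

end Info

section SingleLetter

variable {U B C D : Type*} [Fintype U] [Fintype B] [Fintype C] [Fintype D]
  {pU : U → ℝ} {q : U → B → C → ℝ} {K : B → C → D → ℝ}

theorem law_jointLaw_fst_input (hK1 : ∀ b c, ∑ d, K b c d = 1) (b : B) (u : U) :
    law (jointLaw pU q K) (fun ω => (ω.2.1, ω.1)) (b, u) = pU u * marg (q u) b := by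
  classical
  simp only [law, Finset.sum_filter, Fintype.sum_prod_type, Prod.mk.injEq, ite_and, jointLaw]
  simp [← Finset.mul_sum, hK1, marg]

theorem law_jointLaw_state (h1 : ∀ u, ∑ b, ∑ c, q u b c = 1) (hK1 : ∀ b c, ∑ d, K b c d = 1)
    (u : U) : law (jointLaw pU q K) (fun ω => ω.1) u = pU u := by
  classical
  simp only [law, Finset.sum_filter, Fintype.sum_prod_type, jointLaw]
  simp [← Finset.mul_sum, hK1, h1]

theorem law_jointLaw_fst_output (b : B) (d : D) (u : U) :
    law (jointLaw pU q K) (fun ω => (ω.2.1, ω.2.2.2, ω.1)) (b, d, u) =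
      pU u * outJoint (q u) K b d := by
  classical
  simp only [law, Finset.sum_filter, Fintype.sum_prod_type, Prod.mk.injEq, ite_and, jointLaw]
  simp [← Finset.mul_sum, outJoint, mul_assoc]

theorem law_jointLaw_output (d : D) (u : U) :
    law (jointLaw pU q K) (fun ω => (ω.2.2.2, ω.1)) (d, u) = pU u * outMarg (q u) K d := by
  classical
  simp only [law, Finset.sum_filter, Fintype.sum_prod_type, Prod.mk.injEq, ite_and, jointLaw]
  simp [← Finset.mul_sum, outJoint, outMarg, mul_assoc]

theorem law_jointLaw_all (b : B) (c : C) (d : D) (u : U) :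
    law (jointLaw pU q K) (fun ω => (ω.2.1, ω.2.2.2, ω.2.2.1, ω.1)) (b, d, c, u) =
      pU u * q u b c * K b c d := by
  classical
  simp only [law, Finset.sum_filter, Fintype.sum_prod_type, Prod.mk.injEq, ite_and, jointLaw]
  simp

theorem law_jointLaw_snd_output (hq : ∀ u b c, 0 ≤ q u b c) (c : C) (d : D) (u : U) :
    law (jointLaw pU q K) (fun ω => (ω.2.2.2, ω.2.2.1, ω.1)) (d, c, u) =
      pU u * (marg (flip (q u)) c * outCond (q u) K c d) := by
  classical
  simp only [law, Finset.sum_filter, Fintype.sum_prod_type, Prod.mk.injEq, ite_and, jointLaw]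
  simp only [Finset.sum_ite_irrel, Finset.sum_ite_eq', Finset.mem_univ,
    if_true, Finset.sum_const_zero]
  rw [outCond, Finset.mul_sum, Finset.mul_sum]
  refine Finset.sum_congr rfl fun b _ => ?_
  linear_combination (-pU u * K b c d) * marg_mul_corr (hq u) b c

theorem packInfo_eq (hU : ∀ u, 0 ≤ pU u) (hq : ∀ u b c, 0 ≤ q u b c)
    (h1 : ∀ u, ∑ b, ∑ c, q u b c = 1) (hK : ∀ b c d, 0 ≤ K b c d)
    (hK1 : ∀ b c, ∑ d, K b c d = 1) :
    packInfo pU q K = condMutualInfo (jointLaw pU q K) (fun ω => ω.2.1) (fun ω => ω.2.2.2)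
      (fun ω => ω.1) := by
  rw [packInfo, condMutualInfo, condEntropy_eq_sum, condEntropy_eq_sum,
    ← Finset.sum_neg_distrib, ← Finset.sum_neg_distrib, ← Finset.sum_sub_distrib]
  refine Finset.sum_congr rfl fun ω _ => ?_
  obtain ⟨u, b, c, d⟩ := ω
  rcases (jointLaw_nonneg hU hq hK (u, b, c, d)).eq_or_lt with h | h
  · rw [← h]; simp
  obtain ⟨h₁, h₂, h₃, h₄, -⟩ := pos_of_jointLaw_pos hU hq hK h
  simp only [law_jointLaw_fst_input hK1, law_jointLaw_state h1 hK1, law_jointLaw_fst_output,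
    law_jointLaw_output, packDens]
  rw [mul_div_mul_left _ _ h₁.ne', mul_div_cancel_left₀ _ h₁.ne',
    Real.logb_div h₂.ne' (mul_pos h₃ h₄).ne', Real.logb_mul h₃.ne' h₄.ne',
    Real.logb_div h₂.ne' h₄.ne']
  ring

theorem covInfo_eq (hU : ∀ u, 0 ≤ pU u) (hq : ∀ u b c, 0 ≤ q u b c)
    (h1 : ∀ u, ∑ b, ∑ c, q u b c = 1) (hK : ∀ b c d, 0 ≤ K b c d)
    (hK1 : ∀ b c, ∑ d, K b c d = 1) :
    covInfo pU q K = condEntropy (jointLaw pU q K) (fun ω => ω.2.1) (fun ω => ω.1) -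
      condEntropy (jointLaw pU q K) (fun ω => ω.2.1) (fun ω => (ω.2.2.2, ω.2.2.1, ω.1)) := by
  rw [covInfo, condEntropy_eq_sum, condEntropy_eq_sum,
    ← Finset.sum_neg_distrib, ← Finset.sum_neg_distrib, ← Finset.sum_sub_distrib]
  refine Finset.sum_congr rfl fun ω _ => ?_
  obtain ⟨u, b, c, d⟩ := ω
  rcases (jointLaw_nonneg hU hq hK (u, b, c, d)).eq_or_lt with h | h
  · rw [← h]; simp
  obtain ⟨h₁, -, h₃, -, h₅, h₆, h₇⟩ := pos_of_jointLaw_pos hU hq hK h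
  simp only [law_jointLaw_fst_input hK1, law_jointLaw_state h1 hK1, law_jointLaw_all,
    law_jointLaw_snd_output hq, covDens]
  have e : pU u * q u b c * K b c d / (pU u * (marg (flip (q u)) c * outCond (q u) K c d)) =
      marg (q u) b * (corr (q u) b c * K b c d / outCond (q u) K c d) := by
    rw [← marg_mul_corr (hq u) b c]
    field_simp
  rw [e, mul_div_cancel_left₀ _ h₁.ne', Real.logb_mul h₃.ne' (div_pos h₆ h₇).ne']
  ring

/-- Gibbs' inequality. -/
theorem covInfo_nonneg (hU : ∀ u, 0 ≤ pU u) (hU1 : ∑ u, pU u = 1) (hq : ∀ u b c, 0 ≤ q u b c)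
    (h1 : ∀ u, ∑ b, ∑ c, q u b c = 1) (hK : ∀ b c d, 0 ≤ K b c d)
    (hK1 : ∀ b c, ∑ d, K b c d = 1) : 0 ≤ covInfo pU q K := by
  have hl : 0 < Real.log 2 := Real.log_pos (by norm_num)
  set r : U × B × C × D → ℝ := fun ω => pU ω.1 * (marg (q ω.1) ω.2.1 *
    (marg (flip (q ω.1)) ω.2.2.1 * outCond (q ω.1) K ω.2.2.1 ω.2.2.2)) with hr
  have hr0 : ∀ ω, 0 ≤ r ω := fun ω => mul_nonneg (hU _) (mul_nonneg (marg_nonneg (hq _) _)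
    (mul_nonneg (marg_nonneg (fun _ _ => hq _ _ _) _) (outCond_nonneg (hq _) hK _ _)))
  have hr1 : ∑ ω, r ω ≤ 1 := by
    simp only [hr, Fintype.sum_prod_type, ← Finset.mul_sum]
    rw [← hU1]
    refine Finset.sum_le_sum fun u _ => mul_le_of_le_one_right (hU u) ?_
    rw [← Finset.sum_mul, sum_marg (h1 u), one_mul, ← sum_marg_flip (h1 u)]
    refine Finset.sum_le_sum fun c _ => ?_
    rcases (marg_nonneg (q := flip (q u)) (fun _ _ => hq u _ _) c).eq_or_lt with h | h
    · rw [← h, zero_mul]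
    · rw [sum_outCond (hq u) hK1 h, mul_one]
  have hpt : ∀ ω, (jointLaw pU q K ω - r ω) / Real.log 2 ≤ jointLaw pU q K ω *
      Real.logb 2 (covDens (q ω.1) K ω.2.1 ω.2.2.1 ω.2.2.2) := by
    rintro ⟨u, b, c, d⟩
    rw [Real.logb, ← mul_div_assoc]
    refine div_le_div_of_nonneg_right ?_ hl.le
    rcases (jointLaw_nonneg hU hq hK (u, b, c, d)).eq_or_lt with h | h
    · rw [← h, zero_mul, zero_sub]; exact neg_nonpos.2 (hr0 _)
    obtain ⟨h₁, -, h₃, -, h₅, h₆, h₇⟩ := pos_of_jointLaw_pos hU hq hK h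
    have e : jointLaw pU q K (u, b, c, d) * (1 - (covDens (q u) K b c d)⁻¹) =
        jointLaw pU q K (u, b, c, d) - r (u, b, c, d) := by
      have h₈ : K b c d ≠ 0 := right_ne_zero_of_mul h₆.ne'
      have h₉ : corr (q u) b c ≠ 0 := left_ne_zero_of_mul h₆.ne'
      simp only [hr, jointLaw, covDens]
      rw [← marg_mul_corr (hq u) b c]
      field_simp
    rw [← e]
    exact mul_le_mul_of_nonneg_left (Real.one_sub_inv_le_log_of_pos (div_pos h₆ h₇)) h.le
  have h2 := Finset.sum_le_sum fun ω (_ : ω ∈ Finset.univ) => hpt ω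
  rw [← Finset.sum_div, Finset.sum_sub_distrib, sum_jointLaw hU1 h1 hK1] at h2
  exact le_trans (div_nonneg (sub_nonneg.2 hr1) hl.le) h2

end SingleLetter

section Channel

variable {X Y₁ Y₂ U V₁ V₂ : Type*} [Fintype X] [Fintype Y₁] [Fintype Y₂]
    [Fintype U] [Fintype V₁] [Fintype V₂]

/-- The channel to the first receiver. -/
noncomputable def BroadcastChannel.fstProb (W : BroadcastChannel X Y₁ Y₂) (x : X) (y : Y₁) : ℝ :=
  ∑ y₂, W.prob x (y, y₂)

/-- The channel to the second receiver. -/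
noncomputable def BroadcastChannel.sndProb (W : BroadcastChannel X Y₁ Y₂) (x : X) (y : Y₂) : ℝ :=
  ∑ y₁, W.prob x (y₁, y)

/-- The channel `V` preceded by the channel `pX` from pairs of auxiliary letters to inputs. -/
noncomputable def prefixed {Y : Type*} (pX : V₁ × V₂ → X → ℝ) (V : X → Y → ℝ)
    (v₁ : V₁) (v₂ : V₂) (y : Y) : ℝ :=
  ∑ x, pX (v₁, v₂) x * V x y

theorem prefixed_nonneg {Y : Type*} {pX : V₁ × V₂ → X → ℝ} {V : X → Y → ℝ}
    (hX : ∀ v x, 0 ≤ pX v x) (hV : ∀ x y, 0 ≤ V x y) (v₁ : V₁) (v₂ : V₂) (y : Y) :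
    0 ≤ prefixed pX V v₁ v₂ y :=
  Finset.sum_nonneg fun x _ => mul_nonneg (hX _ x) (hV x y)

theorem sum_prefixed {Y : Type*} [Fintype Y] {pX : V₁ × V₂ → X → ℝ} {V : X → Y → ℝ}
    (hX : ∀ v, ∑ x, pX v x = 1) (hV : ∀ x, ∑ y, V x y = 1) (v₁ : V₁) (v₂ : V₂) :
    ∑ y, prefixed pX V v₁ v₂ y = 1 := by
  simp only [prefixed]
  rw [Finset.sum_comm]
  simp only [← Finset.mul_sum, hV, mul_one, hX]

theorem BroadcastChannel.fstProb_nonneg (W : BroadcastChannel X Y₁ Y₂) (x : X) (y : Y₁) :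
    0 ≤ W.fstProb x y := Finset.sum_nonneg fun _ _ => (W.prob_mem x).1 _

theorem BroadcastChannel.sndProb_nonneg (W : BroadcastChannel X Y₁ Y₂) (x : X) (y : Y₂) :
    0 ≤ W.sndProb x y := Finset.sum_nonneg fun _ _ => (W.prob_mem x).1 _

theorem BroadcastChannel.sum_fstProb (W : BroadcastChannel X Y₁ Y₂) (x : X) :
    ∑ y, W.fstProb x y = 1 := by
  rw [← (W.prob_mem x).2, Fintype.sum_prod_type]; rfl

theorem BroadcastChannel.sum_sndProb (W : BroadcastChannel X Y₁ Y₂) (x : X) :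
    ∑ y, W.sndProb x y = 1 := by
  rw [← (W.prob_mem x).2, Fintype.sum_prod_type, Finset.sum_comm]; rfl

variable {W : BroadcastChannel X Y₁ Y₂} {P : U × V₁ × V₂ × X × Y₁ × Y₂ → ℝ} {pU : U → ℝ}
  {q : U → V₁ → V₂ → ℝ} {pX : V₁ × V₂ → X → ℝ}

theorem law_fst_output (hP : ∀ u v₁ v₂ x y₁ y₂, P (u, v₁, v₂, x, y₁, y₂) =
      pU u * q u v₁ v₂ * pX (v₁, v₂) x * W.prob x (y₁, y₂)) :
    law P (fun ω => (rvU ω, rvV₁ ω, rvV₂ ω, rvY₁ ω)) =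
    jointLaw pU q (prefixed pX W.fstProb) := by
  classical
  funext ⟨u, v₁, v₂, y⟩
  simp only [law, Finset.sum_filter, Fintype.sum_prod_type, Prod.mk.injEq, ite_and, jointLaw,
    rvU, rvV₁, rvV₂, rvY₁, hP]
  simp [prefixed, BroadcastChannel.fstProb, Finset.mul_sum, mul_assoc]

theorem law_snd_output (hP : ∀ u v₁ v₂ x y₁ y₂, P (u, v₁, v₂, x, y₁, y₂) =
      pU u * q u v₁ v₂ * pX (v₁, v₂) x * W.prob x (y₁, y₂)) :
    law P (fun ω => (rvU ω, rvV₁ ω, rvV₂ ω, rvY₂ ω)) =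
    jointLaw pU q (prefixed pX W.sndProb) := by
  classical
  funext ⟨u, v₁, v₂, y⟩
  simp only [law, Finset.sum_filter, Fintype.sum_prod_type, Prod.mk.injEq, ite_and, jointLaw,
    rvU, rvV₁, rvV₂, rvY₂, hP]
  simp [prefixed, BroadcastChannel.sndProb, Finset.mul_sum, mul_assoc]

theorem bound₁_eq (hP : ∀ u v₁ v₂ x y₁ y₂, P (u, v₁, v₂, x, y₁, y₂) =
      pU u * q u v₁ v₂ * pX (v₁, v₂) x * W.prob x (y₁, y₂)) (hU : ∀ u, 0 ≤ pU u)
    (hq : ∀ u b c, 0 ≤ q u b c) (h1 : ∀ u, ∑ b, ∑ c, q u b c = 1) (hX : ∀ v x, 0 ≤ pX v x)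
    (hX1 : ∀ v, ∑ x, pX v x = 1) :
    bound₁ P = packInfo pU q (prefixed pX W.fstProb) - covInfo pU q (prefixed pX W.sndProb) := by
  rw [packInfo_eq hU hq h1 (prefixed_nonneg hX W.fstProb_nonneg) (sum_prefixed hX1 W.sum_fstProb),
    covInfo_eq hU hq h1 (prefixed_nonneg hX W.sndProb_nonneg) (sum_prefixed hX1 W.sum_sndProb),
    ← law_fst_output hP, ← law_snd_output hP]
  simp only [bound₁, condMutualInfo, ← condEntropy_comp]
  ring

theorem bound₂_eq (hP : ∀ u v₁ v₂ x y₁ y₂, P (u, v₁, v₂, x, y₁, y₂) =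
      pU u * q u v₁ v₂ * pX (v₁, v₂) x * W.prob x (y₁, y₂)) (hU : ∀ u, 0 ≤ pU u)
    (hq : ∀ u b c, 0 ≤ q u b c) (h1 : ∀ u, ∑ b, ∑ c, q u b c = 1) (hX : ∀ v x, 0 ≤ pX v x)
    (hX1 : ∀ v, ∑ x, pX v x = 1) :
    bound₂ P = packInfo pU (fun u => flip (q u)) (fun c b => prefixed pX W.sndProb b c) -
      covInfo pU (fun u => flip (q u)) (fun c b => prefixed pX W.fstProb b c) := by
  have hP0 : ∀ ω, 0 ≤ P ω := by
    rintro ⟨u, v₁, v₂, x, y₁, y₂⟩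
    rw [hP]
    exact mul_nonneg (mul_nonneg (mul_nonneg (hU u) (hq _ _ _)) (hX _ _)) ((W.prob_mem x).1 _)
  have h1' : ∀ u, ∑ c, ∑ b, flip (q u) c b = 1 := fun u => by
    rw [← h1 u, Finset.sum_comm]; rfl
  have l₁ : law P (fun ω => (rvU ω, rvV₂ ω, rvV₁ ω, rvY₁ ω)) =
      jointLaw pU (fun u => flip (q u)) (fun c b => prefixed pX W.fstProb b c) := by
    funext ω
    change _ = jointLaw pU q (prefixed pX W.fstProb) (ω.1, ω.2.2.1, ω.2.1, ω.2.2.2)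
    rw [← law_fst_output hP]
    obtain ⟨u, c, b, d⟩ := ω
    simp only [law]
    congr 1; ext; simp only [Finset.mem_filter, Finset.mem_univ, true_and, Prod.mk.injEq]; tauto
  have l₂ : law P (fun ω => (rvU ω, rvV₂ ω, rvV₁ ω, rvY₂ ω)) =
      jointLaw pU (fun u => flip (q u)) (fun c b => prefixed pX W.sndProb b c) := by
    funext ω
    change _ = jointLaw pU q (prefixed pX W.sndProb) (ω.1, ω.2.2.1, ω.2.1, ω.2.2.2)
    rw [← law_snd_output hP]
    obtain ⟨u, c, b, d⟩ := ω
    simp only [law]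
    congr 1; ext; simp only [Finset.mem_filter, Finset.mem_univ, true_and, Prod.mk.injEq]; tauto
  rw [packInfo_eq (q := fun u => flip (q u)) (K := fun c b => prefixed pX W.sndProb b c) hU
      (fun u c b => hq u b c) h1'
      (fun c b => prefixed_nonneg hX W.sndProb_nonneg b c)
      (fun c b => sum_prefixed hX1 W.sum_sndProb b c),
    covInfo_eq (q := fun u => flip (q u)) (K := fun c b => prefixed pX W.fstProb b c) hU
      (fun u c b => hq u b c) h1'
      (fun c b => prefixed_nonneg hX W.fstProb_nonneg b c)
      (fun c b => sum_prefixed hX1 W.sum_fstProb b c), ← l₁, ← l₂, bound₂,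
    condMutualInfo_comm hP0 rvV₁ rvV₂ rvU]
  simp only [condMutualInfo, ← condEntropy_comp]
  ring

end Channel

/-! ### The code obtained from a codebook -/

section CodeConstruction

variable {X Y₁ Y₂ V₁ V₂ : Type*} [Fintype X] [Fintype Y₁] [Fintype Y₂] [Fintype V₁] [Fintype V₂]

theorem sum_input_output_fst (W : BroadcastChannel X Y₁ Y₂) (pX : V₁ × V₂ → X → ℝ) {n : ℕ}
    (b : Fin n → V₁) (c : Fin n → V₂) (F : (Fin n → Y₁) → ℝ) :
    ∑ x : Fin n → X, ∑ y : Fin n → Y₁ × Y₂, (∏ i, pX (b i, c i) (x i)) * W.blockProb x y *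
      F (fun i => (y i).1) = ∑ d, blockKernel (prefixed pX W.fstProb) b c d * F d := by
  have h : ∀ x : Fin n → X, ∑ y : Fin n → Y₁ × Y₂, (∏ i, pX (b i, c i) (x i)) *
      W.blockProb x y * F (fun i => (y i).1) =
      ∑ d, (∏ i, pX (b i, c i) (x i) * W.fstProb (x i) (d i)) * F d := by
    intro x
    rw [sum_pi_prod]
    refine Finset.sum_congr rfl fun d _ => ?_
    dsimp only
    rw [← Finset.sum_mul, ← Finset.mul_sum, Finset.prod_mul_distrib]
    congr 2
    exact sum_prod_apply fun i e => W.prob (x i) (d i, e)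
  simp only [h]
  rw [Finset.sum_comm]
  refine Finset.sum_congr rfl fun d _ => ?_
  rw [← Finset.sum_mul]
  congr 1
  exact sum_prod_apply fun i x => pX (b i, c i) x * W.fstProb x (d i)

theorem sum_input_output_snd (W : BroadcastChannel X Y₁ Y₂) (pX : V₁ × V₂ → X → ℝ) {n : ℕ}
    (b : Fin n → V₁) (c : Fin n → V₂) (F : (Fin n → Y₂) → ℝ) :
    ∑ x : Fin n → X, ∑ y : Fin n → Y₁ × Y₂, (∏ i, pX (b i, c i) (x i)) * W.blockProb x y *
      F (fun i => (y i).2) = ∑ d, blockKernel (prefixed pX W.sndProb) b c d * F d := by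
  have h : ∀ x : Fin n → X, ∑ y : Fin n → Y₁ × Y₂, (∏ i, pX (b i, c i) (x i)) *
      W.blockProb x y * F (fun i => (y i).2) =
      ∑ d, (∏ i, pX (b i, c i) (x i) * W.sndProb (x i) (d i)) * F d := by
    intro x
    rw [sum_pi_prod, Finset.sum_comm]
    refine Finset.sum_congr rfl fun d _ => ?_
    dsimp only
    rw [← Finset.sum_mul, ← Finset.mul_sum, Finset.prod_mul_distrib]
    congr 2
    exact sum_prod_apply fun i e => W.prob (x i) (e, d i)
  simp only [h]
  rw [Finset.sum_comm]
  refine Finset.sum_congr rfl fun d _ => ?_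
  rw [← Finset.sum_mul]
  congr 1
  exact sum_prod_apply fun i x => pX (b i, c i) x * W.sndProb x (d i)

variable {n M₁ M₂ J₁ J₂ : ℕ}

/-- The code that, for the messages `w₁, w₂`, draws codeword indices from `s w₁ w₂` and sends the
two codewords through the channel `pX`. -/
noncomputable def Code.ofCodebook {pX : V₁ × V₂ → X → ℝ} (hX : ∀ v, pX v ∈ stdSimplex ℝ X)
    (c₁ : Fin M₁ × Fin J₁ → Fin n → V₁) (c₂ : Fin M₂ × Fin J₂ → Fin n → V₂)
    {s : Fin M₁ → Fin M₂ → Fin J₁ → Fin J₂ → ℝ} (hs : ∀ w₁ w₂ j₁ j₂, 0 ≤ s w₁ w₂ j₁ j₂)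
    (hs1 : ∀ w₁ w₂, ∑ j₁, ∑ j₂, s w₁ w₂ j₁ j₂ = 1)
    (φ₁ : (Fin n → Y₁) → Fin M₁) (φ₂ : (Fin n → Y₂) → Fin M₂) :
    Code X Y₁ Y₂ n M₁ M₂ where
  enc w x := ∑ j₁, ∑ j₂, s w.1 w.2 j₁ j₂ * ∏ i, pX (c₁ (w.1, j₁) i, c₂ (w.2, j₂) i) (x i)
  enc_mem w := by
    refine ⟨fun x => Finset.sum_nonneg fun j₁ _ => Finset.sum_nonneg fun j₂ _ =>
      mul_nonneg (hs _ _ _ _) (Finset.prod_nonneg fun i _ => (hX _).1 _), ?_⟩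
    rw [← hs1 w.1 w.2, Finset.sum_comm]
    refine Finset.sum_congr rfl fun j₁ _ => ?_
    rw [Finset.sum_comm]
    refine Finset.sum_congr rfl fun j₂ _ => ?_
    rw [← Finset.mul_sum, sum_prod_apply fun i x => pX (c₁ (w.1, j₁) i, c₂ (w.2, j₂) i) x,
      Finset.prod_eq_one fun i _ => (hX _).2, mul_one]
  dec₁ := φ₁
  dec₂ := φ₂

/-- The mean, under the joint law of messages, input and outputs, of a function of the messages and
the output block at the first receiver. -/
theorem sum_joint_ofCodebook_fst (W : BroadcastChannel X Y₁ Y₂) {pX : V₁ × V₂ → X → ℝ}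
    (hX : ∀ v, pX v ∈ stdSimplex ℝ X)
    (c₁ : Fin M₁ × Fin J₁ → Fin n → V₁) (c₂ : Fin M₂ × Fin J₂ → Fin n → V₂)
    {s : Fin M₁ → Fin M₂ → Fin J₁ → Fin J₂ → ℝ} (hs : ∀ w₁ w₂ j₁ j₂, 0 ≤ s w₁ w₂ j₁ j₂)
    (hs1 : ∀ w₁ w₂, ∑ j₁, ∑ j₂, s w₁ w₂ j₁ j₂ = 1)
    (φ₁ : (Fin n → Y₁) → Fin M₁) (φ₂ : (Fin n → Y₂) → Fin M₂)
    (F : Fin M₁ × Fin M₂ → (Fin n → Y₁) → ℝ) :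
    ∑ ω, (Code.ofCodebook hX c₁ c₂ hs hs1 φ₁ φ₂).joint W ω * F ω.1 (fun i => (ω.2.2 i).1) =
    1 / ((M₁ : ℝ) * M₂) * ∑ w₁, ∑ w₂, ∑ j₁, ∑ j₂, s w₁ w₂ j₁ j₂ *
      ∑ d, blockKernel (prefixed pX W.fstProb) (c₁ (w₁, j₁)) (c₂ (w₂, j₂)) d * F (w₁, w₂) d := by
  simp only [Fintype.sum_prod_type (α₁ := Fin M₁ × Fin M₂),
    Fintype.sum_prod_type (α₁ := Fin n → X)]
  rw [Fintype.sum_prod_type, Finset.mul_sum]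
  refine Finset.sum_congr rfl fun w₁ _ => ?_
  rw [Finset.mul_sum]
  refine Finset.sum_congr rfl fun w₂ _ => ?_
  simp only [← sum_input_output_fst, Finset.mul_sum, Code.joint, Code.ofCodebook, Finset.sum_mul]
  rw [Finset.sum_congr rfl fun x _ => Finset.sum_comm, Finset.sum_comm]
  refine Finset.sum_congr rfl fun j₁ _ => ?_
  rw [Finset.sum_congr rfl fun x _ => Finset.sum_comm, Finset.sum_comm]
  exact Finset.sum_congr rfl fun j₂ _ => Finset.sum_congr rfl fun x _ =>
    Finset.sum_congr rfl fun y _ => by ring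

/-- The analogue of `sum_joint_ofCodebook_fst` for the second receiver. -/
theorem sum_joint_ofCodebook_snd (W : BroadcastChannel X Y₁ Y₂) {pX : V₁ × V₂ → X → ℝ}
    (hX : ∀ v, pX v ∈ stdSimplex ℝ X)
    (c₁ : Fin M₁ × Fin J₁ → Fin n → V₁) (c₂ : Fin M₂ × Fin J₂ → Fin n → V₂)
    {s : Fin M₁ → Fin M₂ → Fin J₁ → Fin J₂ → ℝ} (hs : ∀ w₁ w₂ j₁ j₂, 0 ≤ s w₁ w₂ j₁ j₂)
    (hs1 : ∀ w₁ w₂, ∑ j₁, ∑ j₂, s w₁ w₂ j₁ j₂ = 1)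
    (φ₁ : (Fin n → Y₁) → Fin M₁) (φ₂ : (Fin n → Y₂) → Fin M₂)
    (F : Fin M₁ × Fin M₂ → (Fin n → Y₂) → ℝ) :
    ∑ ω, (Code.ofCodebook hX c₁ c₂ hs hs1 φ₁ φ₂).joint W ω * F ω.1 (fun i => (ω.2.2 i).2) =
    1 / ((M₁ : ℝ) * M₂) * ∑ w₁, ∑ w₂, ∑ j₁, ∑ j₂, s w₁ w₂ j₁ j₂ *
      ∑ d, blockKernel (prefixed pX W.sndProb) (c₁ (w₁, j₁)) (c₂ (w₂, j₂)) d * F (w₁, w₂) d := by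
  simp only [Fintype.sum_prod_type (α₁ := Fin M₁ × Fin M₂),
    Fintype.sum_prod_type (α₁ := Fin n → X)]
  rw [Fintype.sum_prod_type, Finset.mul_sum]
  refine Finset.sum_congr rfl fun w₁ _ => ?_
  rw [Finset.mul_sum]
  refine Finset.sum_congr rfl fun w₂ _ => ?_
  simp only [← sum_input_output_snd, Finset.mul_sum, Code.joint, Code.ofCodebook, Finset.sum_mul]
  rw [Finset.sum_congr rfl fun x _ => Finset.sum_comm, Finset.sum_comm]
  refine Finset.sum_congr rfl fun j₁ _ => ?_
  rw [Finset.sum_congr rfl fun x _ => Finset.sum_comm, Finset.sum_comm]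
  exact Finset.sum_congr rfl fun j₂ _ => Finset.sum_congr rfl fun x _ =>
    Finset.sum_congr rfl fun y _ => by ring

theorem Code.joint_nonneg (C : Code X Y₁ Y₂ n M₁ M₂) (W : BroadcastChannel X Y₁ Y₂)
    (ω : (Fin M₁ × Fin M₂) × (Fin n → X) × (Fin n → Y₁ × Y₂)) : 0 ≤ C.joint W ω :=
  mul_nonneg (mul_nonneg (by positivity) ((C.enc_mem _).1 _))
    (Finset.prod_nonneg fun _ _ => (W.prob_mem _).1 _)

theorem Code.sum_joint (C : Code X Y₁ Y₂ n M₁ M₂) (W : BroadcastChannel X Y₁ Y₂) (hM₁ : 0 < M₁)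
    (hM₂ : 0 < M₂) : ∑ ω, C.joint W ω = 1 := by
  have h : ∀ x : Fin n → X, ∑ y, W.blockProb x y = 1 := fun x => by
    simp only [BroadcastChannel.blockProb]
    rw [sum_prod_apply fun i y => W.prob (x i) y]
    exact Finset.prod_eq_one fun i _ => (W.prob_mem _).2
  simp only [Fintype.sum_prod_type (α₁ := Fin M₁ × Fin M₂),
    Fintype.sum_prod_type (α₁ := Fin n → X), Code.joint, ← Finset.mul_sum, h, mul_one,
    (C.enc_mem _).2]
  rw [Finset.sum_const, Finset.card_univ, Fintype.card_prod, Fintype.card_fin, Fintype.card_fin,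
    nsmul_eq_mul, Nat.cast_mul]
  exact mul_one_div_cancel (by positivity)

theorem Code.error₁_eq (C : Code X Y₁ Y₂ n M₁ M₂) (W : BroadcastChannel X Y₁ Y₂) :
    C.error₁ W = ∑ ω, C.joint W ω *
      (if C.dec₁ (fun i => (ω.2.2 i).1) ≠ ω.1.1 then 1 else 0) := by
  simp only [Code.error₁, Code.joint, Fintype.sum_prod_type (α₁ := Fin M₁ × Fin M₂),
    Fintype.sum_prod_type (α₁ := Fin n → X), Finset.mul_sum, Finset.sum_filter, mul_ite, mul_one,
    mul_zero, mul_assoc]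

theorem Code.error₂_eq (C : Code X Y₁ Y₂ n M₁ M₂) (W : BroadcastChannel X Y₁ Y₂) :
    C.error₂ W = ∑ ω, C.joint W ω *
      (if C.dec₂ (fun i => (ω.2.2 i).2) ≠ ω.1.2 then 1 else 0) := by
  simp only [Code.error₂, Code.joint, Fintype.sum_prod_type (α₁ := Fin M₁ × Fin M₂),
    Fintype.sum_prod_type (α₁ := Fin n → X), Finset.mul_sum, Finset.sum_filter, mul_ite, mul_one,
    mul_zero, mul_assoc]

theorem packErr_nonneg {B C D M M' J J' : Type*} [Fintype B] [Fintype C] [Fintype D] [Fintype M]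
    [Fintype M'] [Fintype J] [Fintype J'] [DecidableEq M] {q : B → C → ℝ} {K : B → C → D → ℝ}
    (hq : ∀ b c, 0 ≤ q b c) (hK : ∀ b c d, 0 ≤ K b c d) (φ : D → M) (c₁ : M × J → B)
    (c₂ : M' × J' → C) : 0 ≤ packErr q K φ c₁ c₂ :=
  mul_nonneg (by positivity) (Finset.sum_nonneg fun w₁ _ => Finset.sum_nonneg fun w₂ _ =>
    mul_nonneg (by positivity) (Finset.sum_nonneg fun j₁ _ => Finset.sum_nonneg fun j₂ _ =>
      mul_nonneg (corr_nonneg hq _ _) (Finset.sum_nonneg fun d _ => hK _ _ _)))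

theorem covErr_nonneg {B C D M M' J J' : Type*} [Fintype B] [Fintype C] [Fintype D] [Fintype M]
    [Fintype M'] [Fintype J] [Fintype J'] (q : B → C → ℝ) (K : B → C → D → ℝ) (c₁ : M × J → B)
    (c₂ : M' × J' → C) : 0 ≤ covErr q K c₁ c₂ := by
  unfold covErr; positivity

/-- A good codebook yields a code with small error probabilities and nearly maximal
equivocations. -/
theorem exists_code_of_codebook (W : BroadcastChannel X Y₁ Y₂) {pX : V₁ × V₂ → X → ℝ}
    (hX : ∀ v, pX v ∈ stdSimplex ℝ X) (hM₁ : 0 < M₁) (hM₂ : 0 < M₂) (hJ₁ : 0 < J₁) (hJ₂ : 0 < J₂)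
    {Q : (Fin n → V₁) → (Fin n → V₂) → ℝ} (hQ : ∀ b c, 0 ≤ Q b c)
    {c₁ : Fin M₁ × Fin J₁ → Fin n → V₁} {c₂ : Fin M₂ × Fin J₂ → Fin n → V₂}
    {φ₁ : (Fin n → Y₁) → Fin M₁} {φ₂ : (Fin n → Y₂) → Fin M₂} {η : ℝ}
    (hpos : ∀ l, 0 < marg (flip Q) (c₂ l))
    (hη : packErr Q (blockKernel (prefixed pX W.fstProb)) φ₁ c₁ c₂ +
      packErr (flip Q) (fun c b => blockKernel (prefixed pX W.sndProb) b c) φ₂ c₂ c₁ +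
      (covErr Q (blockKernel (prefixed pX W.sndProb)) c₁ c₂ +
        covErr (flip Q) (fun c b => blockKernel (prefixed pX W.fstProb) b c) c₂ c₁) ≤ η) :
    ∃ C : Code X Y₁ Y₂ n M₁ M₂, C.error₁ W ≤ η ∧ C.error₂ W ≤ η ∧
      Real.logb 2 M₁ - C.equivocation₁ W ≤ 2 * (Real.logb 2 M₁ + 2) * (2 * η) ∧
      Real.logb 2 M₂ - C.equivocation₂ W ≤ 2 * (Real.logb 2 M₂ + 2) * (2 * η) := by
  classical
  have := Fin.pos_iff_nonempty.1 hM₁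
  have := Fin.pos_iff_nonempty.1 hM₂
  have := Fin.pos_iff_nonempty.1 hJ₁
  have := Fin.pos_iff_nonempty.1 hJ₂
  set K₁ := blockKernel (ι := Fin n) (prefixed pX W.fstProb) with hK₁def
  set K₂ := blockKernel (ι := Fin n) (prefixed pX W.sndProb) with hK₂def
  have hK₁ : ∀ b c d, 0 ≤ K₁ b c d :=
    blockKernel_nonneg (prefixed_nonneg (fun v => (hX v).1) W.fstProb_nonneg)
  have hK₂ : ∀ b c d, 0 ≤ K₂ b c d :=
    blockKernel_nonneg (prefixed_nonneg (fun v => (hX v).1) W.sndProb_nonneg)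
  have hK₁1 : ∀ b c, ∑ d, K₁ b c d = 1 :=
    sum_blockKernel (sum_prefixed (fun v => (hX v).2) W.sum_fstProb)
  have hK₂1 : ∀ b c, ∑ d, K₂ b c d = 1 :=
    sum_blockKernel (sum_prefixed (fun v => (hX v).2) W.sum_sndProb)
  have n₁ := packErr_nonneg hQ hK₁ φ₁ c₁ c₂
  have n₂ := packErr_nonneg (q := flip Q) (K := fun c b => K₂ b c) (fun c b => hQ b c)
    (fun c b => hK₂ b c) φ₂ c₂ c₁
  have n₃ := covErr_nonneg Q K₂ c₁ c₂
  have n₄ := covErr_nonneg (flip Q) (fun c b => K₁ b c) c₂ c₁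
  obtain ⟨s, hs, hs1, hsd⟩ := exists_selection hQ hK₂1 c₁ hpos
  have e₁ := selection_error_le (q := Q) hK₁ hK₁1 φ₁ c₁ c₂ s
  have e₂ := selection_error_le (q := flip Q) (K := fun c b => K₂ b c) (fun c b => hK₂ b c)
    (fun c b => hK₂1 b c) φ₂ c₂ c₁ (fun w₂ w₁ j₂ j₁ => s w₁ w₂ j₁ j₂)
  obtain ⟨ν₁, hν₁⟩ := exists_selection_secrecy (q := Q) hK₂ hK₂1 c₁ c₂ s
  obtain ⟨ν₂, hν₂⟩ := exists_selection_secrecy (q := flip Q) (K := fun c b => K₁ b c)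
    (fun c b => hK₁ b c) (fun c b => hK₁1 b c) c₂ c₁ (fun w₂ w₁ j₂ j₁ => s w₁ w₂ j₁ j₂)
  rw [selDist_flip] at e₂ hν₂
  simp only [Fintype.card_fin] at e₁ e₂ hν₁ hν₂
  set C := Code.ofCodebook hX c₁ c₂ hs hs1 φ₁ φ₂ with hC
  have hd₁ : C.dec₁ = φ₁ := rfl
  have hd₂ : C.dec₂ = φ₂ := rfl
  refine ⟨C, ?_, ?_, ?_, ?_⟩
  · rw [Code.error₁_eq, hd₁, hC, sum_joint_ofCodebook_fst W hX c₁ c₂ hs hs1 φ₁ φ₂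
      fun w d => if φ₁ d ≠ w.1 then 1 else 0]
    simp only [mul_ite, mul_one, mul_zero, ← Finset.sum_filter, ← hK₁def]
    linarith
  · rw [Code.error₂_eq, hd₂, hC, sum_joint_ofCodebook_snd W hX c₁ c₂ hs hs1 φ₁ φ₂
      fun w d => if φ₂ d ≠ w.2 then 1 else 0]
    simp only [mul_ite, mul_one, mul_zero, ← Finset.sum_filter, ← hK₂def]
    refine le_trans (le_of_eq ?_) (e₂.trans (by linarith))
    rw [Finset.sum_comm, mul_comm (M₁ : ℝ)]
    congr 1
    refine Finset.sum_congr rfl fun w₂ _ => Finset.sum_congr rfl fun w₁ _ => ?_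
    rw [Finset.sum_comm]
  · have h := logb_card_sub_condEntropy_le (C.joint_nonneg W) (C.sum_joint W hM₁ hM₂)
      (fun ω => ω.1.1) (fun ω i => (ω.2.2 i).2) ν₁
    rw [Fintype.card_fin] at h
    refine h.trans (mul_le_mul_of_nonneg_left (le_trans (le_of_eq ?_)
      (hν₁.trans (by linarith))) ?_)
    · refine Finset.sum_congr rfl fun w₁ _ => Finset.sum_congr rfl fun d _ => ?_
      congr 2
      have hj := sum_joint_ofCodebook_snd W hX c₁ c₂ hs hs1 φ₁ φ₂
        fun w d' => if w.1 = w₁ ∧ d' = d then 1 else 0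
      simp only [mul_ite, mul_one, mul_zero, ← Finset.sum_filter] at hj
      simp only [law, Prod.mk.injEq]
      refine (Eq.trans ?_ hj).trans ?_
      · rfl
      · congr 1
        rw [Finset.sum_eq_single w₁]
        · simp [Finset.filter_eq', ← hK₂def]
        · intro w hw hne; simp [hne]
        · simp
    · have : 0 ≤ Real.logb 2 M₁ := Real.logb_nonneg (by norm_num) (by exact_mod_cast hM₁)
      positivity
  · have h := logb_card_sub_condEntropy_le (C.joint_nonneg W) (C.sum_joint W hM₁ hM₂)
      (fun ω => ω.1.2) (fun ω i => (ω.2.2 i).1) ν₂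
    rw [Fintype.card_fin] at h
    refine h.trans (mul_le_mul_of_nonneg_left (le_trans (le_of_eq ?_)
      (hν₂.trans (by linarith))) ?_)
    · refine Finset.sum_congr rfl fun w₂ _ => Finset.sum_congr rfl fun d _ => ?_
      congr 2
      have hj := sum_joint_ofCodebook_fst W hX c₁ c₂ hs hs1 φ₁ φ₂
        fun w d' => if w.2 = w₂ ∧ d' = d then 1 else 0
      simp only [mul_ite, mul_one, mul_zero, ← Finset.sum_filter] at hj
      simp only [law, Prod.mk.injEq]
      refine (Eq.trans ?_ hj).trans ?_
      · rfl
      · rw [mul_comm (M₁ : ℝ)]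
        congr 1
        refine Finset.sum_congr rfl fun w₁ _ => ?_
        rw [Finset.sum_eq_single w₂, Finset.sum_comm]
        · simp [Finset.filter_eq', ← hK₁def]
        · intro w hw hne; simp [hne]
        · simp
    · have : 0 ≤ Real.logb 2 M₂ := Real.logb_nonneg (by norm_num) (by exact_mod_cast hM₂)
      positivity

end CodeConstruction

/-! ### Choice of rates -/

theorem eventually_rpow_neg_le {δ κ : ℝ} (hδ : 0 < δ) (hκ : 0 < κ) :
    ∀ᶠ n : ℕ in Filter.atTop, (2 : ℝ) ^ (-(n * δ)) ≤ κ := by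
  have h : Filter.Tendsto (fun n : ℕ => ((2 : ℝ) ^ (-δ)) ^ n) Filter.atTop (nhds 0) :=
    tendsto_pow_atTop_nhds_zero_of_lt_one (by positivity)
      (Real.rpow_lt_one_of_one_lt_of_neg (by norm_num) (by linarith))
  filter_upwards [h.eventually_le_const hκ] with n hn
  rw [← Real.rpow_natCast, ← Real.rpow_mul (by norm_num)] at hn
  rwa [show -(n * δ) = -δ * n by ring]

/-- The numbers of messages and of codewords per message for a user with rate `R`, when the
covering needs rate `Ic` and the packing allows rate `Ip`. For `R = 0` a single message is used, so
that nothing has to be decoded and the packing constraint disappears. -/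
theorem exists_rates {R Ic Ip η : ℝ} (hIc : 0 ≤ Ic) (h : R = 0 ∨ R < Ip - Ic)
    (hη : 0 < η) :
    ∃ δ : ℝ, 0 < δ ∧ ∀ᶠ n : ℕ in Filter.atTop, ∃ M J : ℕ, 0 < J ∧ (2 : ℝ) ^ (n * R) ≤ M ∧
      (M : ℝ) ≤ 2 ^ (n * R) + 1 ∧ (2 : ℝ) ^ (n * (Ic + δ)) ≤ η ^ 2 * J ∧
      ((M - 1) * J : ℝ) / 2 ^ (n * (Ip - δ)) ≤ η := by
  -- the slack is spent four times: twice on the size of `J`, once on `T`, once on the decay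
  have key : ∃ δ : ℝ, 0 < δ ∧ (R = 0 ∨ R + Ic + 4 * δ ≤ Ip) := by
    rcases h with h | h
    · exact ⟨1, one_pos, Or.inl h⟩
    · exact ⟨(Ip - Ic - R) / 4, by linarith, Or.inr (by linarith)⟩
  obtain ⟨δ, hδ, hcase⟩ := key
  refine ⟨δ, hδ, ?_⟩
  filter_upwards [eventually_rpow_neg_le hδ (show 0 < η ^ 2 by positivity),
    eventually_rpow_neg_le hδ (show 0 < η / 2 by positivity)] with n hn₁ hn₂
  have hx1 : (1 : ℝ) ≤ 2 ^ (n * (Ic + 2 * δ)) :=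
    Real.one_le_rpow (by norm_num) (by positivity)
  have hJ := Nat.le_ceil ((2 : ℝ) ^ (n * (Ic + 2 * δ)))
  have hJ' := (Nat.ceil_lt_add_one (show (0 : ℝ) ≤ 2 ^ (n * (Ic + 2 * δ)) by positivity)).le
  have hM := Nat.le_ceil ((2 : ℝ) ^ (n * R))
  have hM' := (Nat.ceil_lt_add_one (show (0 : ℝ) ≤ 2 ^ (n * R) by positivity)).le
  refine ⟨⌈(2 : ℝ) ^ (n * R)⌉₊, ⌈(2 : ℝ) ^ (n * (Ic + 2 * δ))⌉₊, Nat.ceil_pos.2 (by positivity),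
    hM, hM', ?_, ?_⟩
  · calc (2 : ℝ) ^ (n * (Ic + δ)) = 2 ^ (-(n * δ)) * 2 ^ (n * (Ic + 2 * δ)) := by
          rw [← Real.rpow_add (by norm_num)]; congr 1; ring
      _ ≤ _ := by gcongr
  · rw [div_le_iff₀ (by positivity)]
    rcases hcase with h0 | h0
    · have : ⌈(2 : ℝ) ^ (n * R)⌉₊ = 1 := by rw [h0]; simp
      rw [this]; simp; positivity
    · calc ((⌈(2 : ℝ) ^ (n * R)⌉₊ : ℝ) - 1) * ⌈(2 : ℝ) ^ (n * (Ic + 2 * δ))⌉₊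
          ≤ 2 ^ (n * R) * (2 * 2 ^ (n * (Ic + 2 * δ))) := by
            refine mul_le_mul (by linarith) (by linarith) (Nat.cast_nonneg _) (by positivity)
        _ = 2 * 2 ^ (n * (R + Ic + 2 * δ)) := by
            rw [mul_left_comm, ← Real.rpow_add (by norm_num)]; congr 2; ring
        _ ≤ 2 * 2 ^ (-(n * δ) + n * (Ip - δ)) := by
            gcongr
            · norm_num
            · nlinarith [Nat.cast_nonneg (α := ℝ) n]
        _ = 2 * (2 ^ (-(n * δ)) * 2 ^ (n * (Ip - δ))) := by rw [Real.rpow_add (by norm_num)]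
        _ ≤ 2 * (η / 2 * 2 ^ (n * (Ip - δ))) := by gcongr
        _ = _ := by ring

/-- A relative equivocation loss of order `η` is a rate loss of order `(R + 3) * η`. -/
theorem rate_sub_equivocation_le {n M : ℕ} {R H η ε : ℝ} (hn : 1 ≤ n) (hR : 0 ≤ R) (hη : 0 ≤ η)
    (hM : (2 : ℝ) ^ (n * R) ≤ M) (hM' : (M : ℝ) ≤ 2 ^ (n * R) + 1)
    (hH : Real.logb 2 M - H ≤ 2 * (Real.logb 2 M + 2) * (2 * η)) (hηε : 4 * (R + 3) * η ≤ ε) :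
    n * R - H ≤ n * ε := by
  have hn' : (1 : ℝ) ≤ n := by exact_mod_cast hn
  have hpos : (0 : ℝ) < 2 ^ (n * R) := by positivity
  have h1 : n * R ≤ Real.logb 2 M := by
    rw [Real.le_logb_iff_rpow_le (by norm_num) (hpos.trans_le hM)]; exact hM
  have h2 : Real.logb 2 M ≤ n * R + 1 := by
    rw [Real.logb_le_iff_le_rpow (by norm_num) (hpos.trans_le hM), Real.rpow_add (by norm_num),
      Real.rpow_one]
    have : (1 : ℝ) ≤ 2 ^ (n * R) := Real.one_le_rpow (by norm_num) (by positivity)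
    linarith
  calc n * R - H ≤ 2 * (Real.logb 2 M + 2) * (2 * η) := by linarith
    _ ≤ 2 * (n * (R + 3)) * (2 * η) := by gcongr; nlinarith
    _ = n * (4 * (R + 3) * η) := by ring
    _ ≤ n * ε := by gcongr

section Achievability

variable {X Y₁ Y₂ U V₁ V₂ : Type*} [Fintype X] [Fintype Y₁] [Fintype Y₂]
    [Fintype U] [Fintype V₁] [Fintype V₂]

theorem achievable_of_lt_bound {W : BroadcastChannel X Y₁ Y₂}
    {P : U × V₁ × V₂ × X × Y₁ × Y₂ → ℝ} (hP : P ∈ piBC W U V₁ V₂) {R₁ R₂ : ℝ} (hR₁ : 0 ≤ R₁)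
    (hR₂ : 0 ≤ R₂) (h₁ : R₁ = 0 ∨ R₁ < bound₁ P) (h₂ : R₂ = 0 ∨ R₂ < bound₂ P) :
    Achievable W R₁ R₂ := by
  obtain ⟨pU, pV, pX, hU, hV, hX, hP⟩ := hP
  set q : U → V₁ → V₂ → ℝ := fun u v₁ v₂ => pV u (v₁, v₂)
  have hq : ∀ u b c, 0 ≤ q u b c := fun u b c => (hV u).1 _
  have hq1 : ∀ u, ∑ b, ∑ c, q u b c = 1 := fun u => by
    rw [← (hV u).2, Fintype.sum_prod_type]
  have hq1' : ∀ u, ∑ c, ∑ b, flip (q u) c b = 1 := fun u => by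
    rw [← hq1 u, Finset.sum_comm]; rfl
  set K₁ : V₁ → V₂ → Y₁ → ℝ := prefixed pX W.fstProb
  set K₂ : V₁ → V₂ → Y₂ → ℝ := prefixed pX W.sndProb
  have hK₁ : ∀ b c d, 0 ≤ K₁ b c d := prefixed_nonneg (fun v => (hX v).1) W.fstProb_nonneg
  have hK₂ : ∀ b c d, 0 ≤ K₂ b c d := prefixed_nonneg (fun v => (hX v).1) W.sndProb_nonneg
  have hK₁1 : ∀ b c, ∑ d, K₁ b c d = 1 := sum_prefixed (fun v => (hX v).2) W.sum_fstProb
  have hK₂1 : ∀ b c, ∑ d, K₂ b c d = 1 := sum_prefixed (fun v => (hX v).2) W.sum_sndProb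
  rw [bound₁_eq (q := q) hP hU.1 hq hq1 (fun v => (hX v).1) fun v => (hX v).2] at h₁
  rw [bound₂_eq (q := q) hP hU.1 hq hq1 (fun v => (hX v).1) fun v => (hX v).2] at h₂
  refine ⟨hR₁, hR₂, fun ε hε => ?_⟩
  obtain ⟨η, hη, hη1, hη₁, hη₂⟩ : ∃ η : ℝ, 0 < η ∧ 10 * η ≤ ε ∧ 4 * (R₁ + 3) * (10 * η) ≤ ε ∧
      4 * (R₂ + 3) * (10 * η) ≤ ε := by
    have h : 40 * (R₁ + R₂ + 3) * (ε / (40 * (R₁ + R₂ + 3))) = ε :=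
      mul_div_cancel₀ _ (by positivity)
    have h0 : 0 < ε / (40 * (R₁ + R₂ + 3)) := by positivity
    refine ⟨_, h0, ?_, ?_, ?_⟩ <;> nlinarith [mul_nonneg hR₁ h0.le, mul_nonneg hR₂ h0.le]
  obtain ⟨δ₁, hδ₁, hr₁⟩ := exists_rates
    (covInfo_nonneg hU.1 hU.2 hq hq1 hK₂ hK₂1) h₁ hη
  obtain ⟨δ₂, hδ₂, hr₂⟩ := exists_rates
    (covInfo_nonneg (q := fun u => flip (q u)) (K := fun c b => K₁ b c) hU.1 hU.2
      (fun u c b => hq u b c) hq1' (fun c b => hK₁ b c) (fun c b => hK₁1 b c)) h₂ hη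
  have hp₁ := eventually_packTail_le hU.1 hU.2 hq hq1 hK₁ hK₁1 hδ₁ hη
  have hp₂ := eventually_packTail_le (q := fun u => flip (q u)) (K := fun c b => K₂ b c) hU.1 hU.2
    (fun u c b => hq u b c) hq1' (fun c b => hK₂ b c) (fun c b => hK₂1 b c) hδ₂ hη
  have hc₁ := eventually_covTail_le hU.1 hU.2 hq hq1 hK₂ hK₂1 hδ₁ hη
  have hc₂ := eventually_covTail_le (q := fun u => flip (q u)) (K := fun c b => K₁ b c) hU.1 hU.2
    (fun u c b => hq u b c) hq1' (fun c b => hK₁ b c) (fun c b => hK₁1 b c) hδ₂ hη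
  obtain ⟨n, hn, ⟨M₁, J₁, hJ₁, hM₁, hM₁', hS₁, hT₁⟩, ⟨M₂, J₂, hJ₂, hM₂, hM₂', hS₂, hT₂⟩, hp₁, hp₂,
    hc₁, hc₂⟩ := ((Filter.eventually_ge_atTop 1).and (hr₁.and (hr₂.and
      (hp₁.and (hp₂.and (hc₁.and hc₂)))))).exists
  have hM₁0 : 0 < M₁ := by
    have : (0 : ℝ) < M₁ := lt_of_lt_of_le (by positivity) hM₁
    exact_mod_cast this
  have hM₂0 : 0 < M₂ := by
    have : (0 : ℝ) < M₂ := lt_of_lt_of_le (by positivity) hM₂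
    exact_mod_cast this
  have := Fin.pos_iff_nonempty.1 hM₁0
  have := Fin.pos_iff_nonempty.1 hM₂0
  have := Fin.pos_iff_nonempty.1 hJ₁
  have := Fin.pos_iff_nonempty.1 hJ₂
  obtain ⟨a, c₁, c₂, φ₁, φ₂, hpos, hbook⟩ := exists_codebook (M₁ := Fin M₁) (M₂ := Fin M₂)
    (J₁ := Fin J₁) (J₂ := Fin J₂) (pA := fun a : Fin n → U => ∏ i, pU (a i))
    (fun a => Finset.prod_nonneg fun i _ => hU.1 _) (sum_prod_eq_one hU.2)
    (q := fun a => blockPair q a) (fun a => blockPair_nonneg hq a) (fun a => sum_blockPair hq1 a)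
    (K₁ := blockKernel K₁) (blockKernel_nonneg hK₁) (sum_blockKernel hK₁1)
    (K₂ := blockKernel K₂) (blockKernel_nonneg hK₂) (sum_blockKernel hK₂1)
    (Real.rpow_pos_of_pos two_pos _) (Real.rpow_pos_of_pos two_pos _)
    (Real.rpow_nonneg two_pos.le _) (Real.rpow_nonneg two_pos.le _) hη.le
    (by simpa using hS₁) (by simpa using hS₂) (by simpa using hT₁) (by simpa using hT₂)
    hp₁ hp₂ hc₁ hc₂
  obtain ⟨C, hC₁, hC₂, hE₁, hE₂⟩ := exists_code_of_codebook W hX hM₁0 hM₂0 hJ₁ hJ₂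
    (blockPair_nonneg hq a) hpos hbook
  exact ⟨n, M₁, M₂, C, hn, hM₁, hM₂, max_le (hC₁.trans hη1) (hC₂.trans hη1),
    rate_sub_equivocation_le hn hR₁ (by positivity) hM₁ hM₁' hE₁ hη₁,
    rate_sub_equivocation_le hn hR₂ (by positivity) hM₂ hM₂' hE₂ hη₂⟩

end Achievability

end BCCM

theorem theorem4 {X Y₁ Y₂ U V₁ V₂ : Type*} [Fintype X] [Fintype Y₁] [Fintype Y₂]
    [Fintype U] [Fintype V₁] [Fintype V₂]
    (W : BCCM.BroadcastChannel X Y₁ Y₂)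
    (P : U × V₁ × V₂ × X × Y₁ × Y₂ → ℝ) (hP : P ∈ BCCM.piBC W U V₁ V₂)
    (R₁ R₂ : ℝ) (hR₁ : 0 ≤ R₁) (hR₂ : 0 ≤ R₂)
    (h₁ : R₁ ≤ BCCM.bound₁ P) (h₂ : R₂ ≤ BCCM.bound₂ P) :
    (R₁, R₂) ∈ BCCM.capacityRegion W ∧
      ((R₁ = 0 ∨ R₁ < BCCM.bound₁ P) → (R₂ = 0 ∨ R₂ < BCCM.bound₂ P) →
        BCCM.Achievable W R₁ R₂) := by
  refine ⟨?_, fun h₁ h₂ => BCCM.achievable_of_lt_bound hP hR₁ hR₂ h₁ h₂⟩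
  -- the pairs `t • (R₁, R₂)` with `t < 1` are achievable and tend to `(R₁, R₂)` as `t → 1`
  have hs : ∀ {R B t : ℝ}, 0 ≤ R → R ≤ B → t < 1 → t * R = 0 ∨ t * R < B := by
    intro R B t hR hRB ht
    rcases hR.eq_or_lt with h | h
    · exact Or.inl (by rw [← h, mul_zero])
    · exact Or.inr (by nlinarith)
  have hcont : Filter.Tendsto (fun t : ℝ => (t * R₁, t * R₂)) (nhdsWithin 1 (Set.Iio 1))
      (nhds (R₁, R₂)) := by
    have : Continuous fun t : ℝ => (t * R₁, t * R₂) := by fun_prop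
    simpa using (this.tendsto 1).mono_left nhdsWithin_le_nhds
  refine mem_closure_of_tendsto hcont ?_
  filter_upwards [Ioo_mem_nhdsLT (show (0 : ℝ) < 1 by norm_num)] with t ht
  exact BCCM.achievable_of_lt_bound hP (mul_nonneg ht.1.le hR₁) (mul_nonneg ht.1.le hR₂)
    (hs hR₁ h₁ ht.2) (hs hR₂ h₂ ht.2)
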